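/- Let $\Omega\subset\mathbb R^2$ be a bounded connected open polygonal set with Lipschitz boundary, and let $\mathcal T_h$ be a conforming triangulation of $\overline\Omega$. Let $\partial\Omega=\partial\Omega_D\cup\partial\Omega_N$ be a partition in which $\partial\Omega_D$ is a nonempty union of closed edges of $\mathcal T_h$. Let $\alpha\le 0\le\beta$, $\xi^-\in[-\frac\pi2,0]$, $\xi^+\in[0,\frac\pi2]$, $\mu_1(s)=\cos s-\alpha\sin s$, $\mu_2(s)=\cos s+\beta\sin s$, $\Gamma_{12}=-\mu_1'/\mu_2$, $\Gamma_{21}=\mu_2'/\mu_1$. Let $\widehat{\Gamma_{12}},\widehat{\Gamma_{21}}$ be the functions equal to $\Gamma_{12},\Gamma_{21}$ on $(\xi^-,\xi^+)$, and extended by their values at $\xi^+$ for $s\ge\xi^+$ and at $\xi^-$ for $s\le\xi^-$. Put $\hat B(s)=\mathrm{diag}(-\widehat{\Gamma_{21}}(s),\widehat{\Gamma_{12}}(s))$, and assume that $\xi^\pm$ are such that $\hat B$ is bounded on $\mathbb R$. Let $\varepsilon>0$. Let $V_h$ be the space of continuous complex-valued functions on $\overline\Omega$ that are affine on each triangle,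 with $\Vert\cdot\Vert_V$ the $H^1(\Omega;\mathbb C)$ norm, and let $V_{h0}:=\{\zeta_h\in V_h : \zeta_h=0\text{ on }\partial\Omega_D\}$. Let $\mathcal I_h$ be a Scott--Zhang interpolator onto the real continuous piecewise affine functions: to each vertex $a$ one edge $F_a\ni a$ of the mesh is assigned, with $F_a\subset\partial\Omega$ if $a\in\partial\Omega$ and $F_a\subset\partial\Omega_D$ if $a\in\partial\Omega_D$, and $(\mathcal I_h v)(a)=\int_{F_a}\psi_a v$, where $\psi_a$ is the affine function on $F_a$ with $\int_{F_a}\psi_a p=p(a)$ for all affine $p$. For $\xi_D\in H^{1/2}(\partial\Omega_D;\mathbb R)$, $g\in L^2(\partial\Omega_N;\mathbb R)$, and $\zeta_D\in H^1(\Omega;\mathbb R)$ with trace $\xi_D$ on $\partial\Omega_D$, let $$V_{hD}:=\{\zeta_h\in V_h : \Re(\zeta_h)=\mathcal I_h\zeta_D\text{ and }\Im(\zeta_h)=0\text{ on }\partial\Omega_D\},$$ $$a_\varepsilon(\xi;\zeta,\tilde\zeta):=\int_\Omega(\hat B(\xi)+i\varepsilon I)\nabla\zeta\cdot\overline{\nabla\tilde\zeta},\qquad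 l(\tilde\zeta):=\int_{\partial\Omega_N}g\,\overline{\tilde\zeta}.$$ (a) For all such $\xi_D,g,\zeta_D$: for every $\xi_h\in V_{hD}$ there is a unique $\zeta_h=:T_h\xi_h\in V_{hD}$ with $a_\varepsilon(\Re(\xi_h);\zeta_h,\tilde\zeta_h)=l(\tilde\zeta_h)$ for all $\tilde\zeta_h\in V_{h0}$; the map $T_h:V_{hD}\to V_{hD}$ is Lipschitz continuous for $\Vert\cdot\Vert_V$; and there exists a fixed point of $T_h$, that is, a solution $\xi_h\in V_{hD}$ of the discrete nonlinear problem $$a_\varepsilon(\Re(\xi_h);\xi_h,\tilde\zeta_h)=l(\tilde\zeta_h),\quad\forall\tilde\zeta_h\in V_{h0}.$$ (b) There is $\delta>0$, which may depend on $\Omega$, $\partial\Omega_D$, $\mathcal T_h$, $\mathcal I_h$, $\alpha,\beta,\xi^\pm$ and $\varepsilon$ but not on the data $\xi_D,g,\zeta_D$, such that the solution $\xi_h\in V_{hD}$ of the discrete nonlinear problem is unique whenever $\Vert\xi_D\Vert_{H^{1/2}(\partial\Omega_D;\mathbb R)}\le\delta$ and $\Vert g\Vert_{L^2(\partial\Omega_N;\mathbb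 R)}\le\delta$. -/

import Mathlib

open MeasureTheory Filter Topology Set
open scoped NNReal ContDiff Matrix ComplexConjugate

noncomputable section

namespace Kirigami

/-- The Euclidean plane. -/
abbrev Plane : Type := EuclideanSpace ℝ (Fin 2)

/-- Arc length: the one-dimensional Hausdorff measure of the Euclidean plane. -/
abbrev arcLength : Measure Plane := Measure.hausdorffMeasure 1

/-! ### The coefficients -/

/-- `μ₁(s) = cos s - α sin s`. -/
def mu1 (α s : ℝ) : ℝ := Real.cos s - α * Real.sin s

/-- `μ₂(s) = cos s + β sin s`. -/
def mu2 (β s : ℝ) : ℝ := Real.cos s + β * Real.sin s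

/-- `Γ₁₂ = - μ₁' / μ₂`. -/
def Gamma12 (α β s : ℝ) : ℝ := -(deriv (mu1 α) s) / mu2 β s

/-- `Γ₂₁ = μ₂' / μ₁`. -/
def Gamma21 (α β s : ℝ) : ℝ := deriv (mu2 β) s / mu1 α s

/-- The cut-off of a coefficient `G`: frozen at its end values outside `(ξm, ξp)`. -/
def cutoff (ξm ξp : ℝ) (G : ℝ → ℝ) (s : ℝ) : ℝ :=
  if ξp ≤ s then G ξp else if s ≤ ξm then G ξm else G s

/-- The cut-off coefficient matrix `diag(-Γ₂₁, Γ₁₂)`, each coefficient being cut off. -/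
def Bhat (α β ξm ξp s : ℝ) : Matrix (Fin 2) (Fin 2) ℝ :=
  !![-cutoff ξm ξp (Gamma21 α β) s, 0; 0, cutoff ξm ξp (Gamma12 α β) s]

/-! ### The domain and its triangulation -/

/-- Near each boundary point, in suitable orthonormal coordinates, `Ω` is the strict epigraph of a
Lipschitz function. -/
def HasLipschitzBoundary (Ω : Set Plane) : Prop :=
  ∀ x ∈ frontier Ω, ∃ U : Set Plane, IsOpen U ∧ x ∈ U ∧
    ∃ (e : Plane ≃ₗᵢ[ℝ] Plane) (L : ℝ≥0) (φ : ℝ → ℝ), LipschitzWith L φ ∧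
      ∀ y ∈ U, (y ∈ Ω ↔ φ (e y 0) < e y 1)

/-- A bounded Lipschitz domain (open, connected, nonempty). That it is polygonal is expressed by
the triangulation that fits it. -/
structure IsLipschitzDomain (Ω : Set Plane) : Prop where
  isOpen : IsOpen Ω
  isConnected : IsConnected Ω
  isBounded : Bornology.IsBounded Ω
  lipschitz : HasLipschitzBoundary Ω

/-- A (conforming) planar triangulation: a simplicial complex in the plane. -/
abbrev Mesh : Type := Geometry.SimplicialComplex ℝ Plane

/-- `K` is a triangulation of `Ω`: it is finite, all its faces are faces of triangles, and the
triangles cover exactly the closure of `Ω`. -/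
structure IsTriangulation (K : Mesh) (Ω : Set Plane) : Prop where
  finite : K.faces.Finite
  pure : ∀ s ∈ K.faces, ∃ t ∈ K.faces, s ⊆ t ∧ t.card = 3
  space_eq : K.space = closure Ω

/-- The union of the (closed) edges of the mesh. -/
def skeleton (K : Mesh) : Set Plane :=
  ⋃ s ∈ {s | s ∈ K.faces ∧ s.card = 2}, convexHull ℝ (s : Set Plane)

/-- `ΓD` is the Dirichlet part of the boundary: a nonempty union of closed mesh edges contained in
`∂Ω` (in particular it is closed, and has positive length). -/
def IsDirichletPart (K : Mesh) (Ω ΓD : Set Plane) : Prop :=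
  ∃ S : Set (Finset Plane), S.Nonempty ∧
    (∀ s ∈ S, s ∈ K.faces ∧ s.card = 2 ∧ convexHull ℝ (s : Set Plane) ⊆ frontier Ω) ∧
    ΓD = ⋃ s ∈ S, convexHull ℝ (s : Set Plane)

/-! ### Function spaces for the data -/

/-- The `H^{1/2}` norm of a function on a curve `Γ` (Sobolev-Slobodeckij norm). -/
def hHalfNorm (Γ : Set Plane) (u : Plane → ℝ) : ENNReal :=
  ((∫⁻ x in Γ, ‖u x‖ₑ ^ 2 ∂arcLength) +
    ∫⁻ x in Γ, ∫⁻ y in Γ, ‖u x - u y‖ₑ ^ 2 / edist x y ^ 2 ∂arcLength ∂arcLength) ^ (1 / 2 : ℝ)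

/-- `u ∈ H^{1/2}(Γ; ℝ)`. -/
def MemHHalf (Γ : Set Plane) (u : Plane → ℝ) : Prop :=
  AEStronglyMeasurable u (arcLength.restrict Γ) ∧ hHalfNorm Γ u < ⊤

/-- `G` is the weak gradient of `u` in the open set `Ω`. -/
def HasWeakGradient (Ω : Set Plane) (u : Plane → ℝ) (G : Plane → Plane) : Prop :=
  ∀ φ : Plane → ℝ, ContDiff ℝ ∞ φ → HasCompactSupport φ → tsupport φ ⊆ Ω → ∀ i : Fin 2,
    ∫ x in Ω, u x * fderiv ℝ φ x (EuclideanSpace.single i 1) = -∫ x in Ω, G x i * φ x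

/-- `u ∈ H¹(Ω; ℝ)`, where the representative `u` is chosen so that its values on the curve `S`
(a Lebesgue null set) are the trace of `u`: functions that are smooth up to the boundary converge
to `u` in `H¹(Ω)` and, at the same time, in `L²(S)`. -/
def MemH1WithTrace (Ω S : Set Plane) (u : Plane → ℝ) : Prop :=
  MemLp u 2 (volume.restrict Ω) ∧ MemLp u 2 (arcLength.restrict S) ∧
  ∃ G : Plane → Plane, MemLp G 2 (volume.restrict Ω) ∧ HasWeakGradient Ω u G ∧
    ∃ φ : ℕ → Plane → ℝ, (∀ n, ContDiff ℝ ∞ (φ n)) ∧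
      Tendsto (fun n => eLpNorm (fun x => φ n x - u x) 2 (volume.restrict Ω)) atTop (𝓝 0) ∧
      Tendsto (fun n => eLpNorm (fun x => gradient (φ n) x - G x) 2 (volume.restrict Ω))
        atTop (𝓝 0) ∧
      Tendsto (fun n => eLpNorm (fun x => φ n x - u x) 2 (arcLength.restrict S)) atTop (𝓝 0)

/-! ### Finite elements -/

/-- Continuous `𝕜`-valued functions on the triangulated set that are affine on each triangle
(first-order Lagrange elements). A function on the triangulated set is represented by its
extension by zero. -/
def P1 (𝕜 : Type) [RCLike 𝕜] (K : Mesh) : Submodule 𝕜 (Plane → 𝕜) where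
  carrier := {v | ContinuousOn v K.space ∧ (∀ x, x ∉ K.space → v x = 0) ∧
    ∀ t ∈ K.faces, t.card = 3 →
      ∃ f : Plane →ᵃ[ℝ] 𝕜, EqOn v f (convexHull ℝ (t : Set Plane))}
  zero_mem' := ⟨continuousOn_const, fun _ _ => rfl, fun _ _ _ => ⟨0, fun _ _ => rfl⟩⟩
  add_mem' := by
    rintro v w ⟨hv1, hv2, hv3⟩ ⟨hw1, hw2, hw3⟩
    refine ⟨hv1.add hw1, fun x hx => by simp [hv2 x hx, hw2 x hx], fun t ht h3 => ?_⟩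
    obtain ⟨f, hf⟩ := hv3 t ht h3
    obtain ⟨f', hf'⟩ := hw3 t ht h3
    exact ⟨f + f', fun x hx => by simp [hf hx, hf' hx]⟩
  smul_mem' := by
    rintro c v ⟨hv1, hv2, hv3⟩
    refine ⟨hv1.const_smul c, fun x hx => by simp [hv2 x hx], fun t ht h3 => ?_⟩
    obtain ⟨f, hf⟩ := hv3 t ht h3
    refine ⟨(LinearMap.mulLeft ℝ c).toAffineMap.comp f, fun x hx => ?_⟩
    simp [hf hx]

/-- The nodes selected for the Scott-Zhang interpolation: to each mesh vertex `a` one associates a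
mesh edge `[a, nb a]`, contained in `∂Ω` if `a ∈ ∂Ω`, and in `ΓD` if `a ∈ ΓD`. -/
def IsScottZhangSelection (K : Mesh) (Ω ΓD : Set Plane) (nb : Plane → Plane) : Prop :=
  ∀ a ∈ K.vertices, nb a ≠ a ∧ (∃ s ∈ K.faces, (s : Set Plane) = {a, nb a}) ∧
    (a ∈ frontier Ω → segment ℝ a (nb a) ⊆ frontier Ω) ∧
    (a ∈ ΓD → segment ℝ a (nb a) ⊆ ΓD)

/-- The Scott-Zhang nodal value `∫_[a,b] ψ u` at the end point `a` of the edge `[a, b]`. Here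
`ψ = (2 / |b - a|) (2 λ_a - λ_b)`, with barycentric coordinates `λ_a = 1 - λ_b` and
`λ_b(x) = |x - a| / |b - a|`, is the affine function on `[a, b]` that is `L²`-dual to the nodal
basis: `∫ ψ λ_a = 1` and `∫ ψ λ_b = 0`. -/
def scottZhangValue (a b : Plane) (u : Plane → ℝ) : ℝ :=
  ∫ x in segment ℝ a b, ((4 - 6 * (dist x a / dist b a)) / dist b a) * u x ∂arcLength

/-- `z` is the Scott-Zhang interpolant of `u`: the piecewise affine function with the
Scott-Zhang nodal values. -/
def IsScottZhangInterpolant (K : Mesh) (nb : Plane → Plane) (u z : Plane → ℝ) : Prop :=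
  z ∈ P1 ℝ K ∧ ∀ a ∈ K.vertices, z a = scottZhangValue a (nb a) u

/-- `V_h`: complex-valued `P¹` elements. -/
abbrev Vh (K : Mesh) : Submodule ℂ (Plane → ℂ) := P1 ℂ K

/-- `V_{hD}`: the real part equals the Scott-Zhang interpolant of `ζD` on `ΓD`, and the imaginary
part vanishes there. -/
def VhD (K : Mesh) (ΓD : Set Plane) (nb : Plane → Plane) (ζD : Plane → ℝ) : Set (Plane → ℂ) :=
  {ζ | ζ ∈ Vh K ∧ ∃ z, IsScottZhangInterpolant K nb ζD z ∧
    ∀ x ∈ ΓD, (ζ x).re = z x ∧ (ζ x).im = 0}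

/-- `V_{h0}`: the elements of `V_h` that vanish on `ΓD`. -/
def Vh0 (K : Mesh) (ΓD : Set Plane) : Set (Plane → ℂ) :=
  {ζ | ζ ∈ Vh K ∧ ∀ x ∈ ΓD, ζ x = 0}

/-- The gradient of a complex function on the plane. For a piecewise affine function it is defined
outside the (Lebesgue null) mesh edges, and is its weak gradient. -/
def cgrad (v : Plane → ℂ) (x : Plane) : Fin 2 → ℂ :=
  fun i => fderiv ℝ v x (EuclideanSpace.single i 1)

/-- The norm of `V = H¹(Ω; ℂ)`. -/
def vNorm (Ω : Set Plane) (v : Plane → ℂ) : ℝ :=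
  √(∫ x in Ω, (‖v x‖ ^ 2 + ∑ i, ‖cgrad v x i‖ ^ 2))

/-! ### The discrete problem -/

/-- `a_ε(ξ; ζ, ζ') = ∫_Ω (B(ξ) + i ε I) ∇ζ · conj(∇ζ')`. -/
def aEps (Ω : Set Plane) (B : ℝ → Matrix (Fin 2) (Fin 2) ℝ) (ε : ℝ) (ξ : Plane → ℝ)
    (ζ ζ' : Plane → ℂ) : ℂ :=
  ∫ x in Ω, (((B (ξ x)).map Complex.ofReal +
    (Complex.I * (ε : ℂ)) • (1 : Matrix (Fin 2) (Fin 2) ℂ)) *ᵥ cgrad ζ x) ⬝ᵥ star (cgrad ζ' x)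

/-- `l(ζ') = ∫_{∂Ω \ ΓD} g conj(ζ')`. -/
def ell (Ω ΓD : Set Plane) (g : Plane → ℝ) (ζ' : Plane → ℂ) : ℂ :=
  ∫ x in frontier Ω \ ΓD, (g x : ℂ) * conj (ζ' x) ∂arcLength

/-- `a_ε(Re ξ; ζ, ζ') = l(ζ')` for all `ζ' ∈ V_{h0}`. -/
def Solves (Ω : Set Plane) (K : Mesh) (ΓD : Set Plane) (B : ℝ → Matrix (Fin 2) (Fin 2) ℝ)
    (ε : ℝ) (g : Plane → ℝ) (ξ ζ : Plane → ℂ) : Prop :=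
  ∀ ζ' ∈ Vh0 K ΓD, aEps Ω B ε (fun x => (ξ x).re) ζ ζ' = ell Ω ΓD g ζ'

/-- Admissible data: `ξD ∈ H^{1/2}(ΓD)`, `g ∈ L²(∂Ω \ ΓD)`, and `ζD ∈ H¹(Ω)` with `ζD = ξD` on `ΓD`
in the sense of traces. -/
structure IsData (Ω : Set Plane) (K : Mesh) (ΓD : Set Plane) (ξD ζD g : Plane → ℝ) : Prop where
  dirichlet : MemHHalf ΓD ξD
  lift : MemH1WithTrace Ω (skeleton K) ζD
  trace_eq : ζD =ᵐ[arcLength.restrict ΓD] ξD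
  neumann : MemLp g 2 (arcLength.restrict (frontier Ω \ ΓD))

end Kirigami

end

open Kirigami

/-! A piecewise affine function is the vector of its vertex values (`IsTriangulation.nodal`), so
everything takes place on a finite-dimensional space with the sup norm, to which the `H¹` norm is
equivalent. Gradients are constant on triangles, and the form becomes a finite sum
(`IsTriangulation.aEps_eq`).

The coefficient matrix has no sign, but it is real and diagonal: it contributes only to the real
part of `a(w, w)`, whose imaginary part is `ε ∫ |∇w|²` (`IsTriangulation.im_form`). With the
discrete Poincaré inequality this gives coercivity uniformly in the frozen argument. The form
depends on that argument in a Lipschitz way, because a bounded cut-off matrix has no poles and is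
therefore Lipschitz (`exists_lipschitz_Bhat`). These facts are collected in `IsCoerciveFamily`.

The rest is abstract. The linear problem is solvable because coercivity gives injectivity. Testing
with `u - z`, where `z` carries the boundary values, bounds the solution uniformly in the frozen
argument. Testing with the difference of two solutions gives `‖T c - T c'‖ ≤ (L ‖T c'‖ / κ) ‖c -
c'‖`. Thus `T` is bounded and Lipschitz, and Brouwer's theorem gives a fixed point. The a priori
bound is linear in the size of the data: the Scott–Zhang values on `ΓD` involve only the trace `ξD`,
and the load only `g`. For small data the Lipschitz factor is below 1, and two fixed points
coincide.

Brouwer's theorem is derived from the absence of a `C¹` retraction of a ball onto its sphere, by the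
volume argument of Milnor and Rogers. -/

noncomputable section

namespace Kirigami

/-! ### Brouwer's fixed point theorem for bounded Lipschitz maps -/

section Brouwer

variable {E : Type*} [NormedAddCommGroup E]

/-- A function that is Lipschitz on a closed ball and vanishes on its boundary sphere is Lipschitz
after extension by zero. -/
lemma lipschitzWith_indicator_closedBall [NormedSpace ℝ E] {g : E → E} {ρ : ℝ} {C : ℝ≥0}
    (hg : LipschitzOnWith C g (Metric.closedBall 0 ρ)) (h0 : ∀ x, ‖x‖ = ρ → g x = 0) :
    LipschitzWith C ((Metric.closedBall (0 : E) ρ).indicator g) := by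
  -- The segment from `x` to `y` crosses the sphere, where `g` vanishes; the crossing point is no
  -- farther from `x` than `y` is.
  have key : ∀ x ∈ Metric.closedBall (0 : E) ρ, ∀ y ∉ Metric.closedBall (0 : E) ρ,
      dist (g x) 0 ≤ C * dist x y := by
    intro x hx y hy
    rw [mem_closedBall_zero_iff] at hx hy
    have hcont : ContinuousOn (fun s : ℝ => ‖x + s • (y - x)‖) (Icc 0 1) := by fun_prop
    obtain ⟨s, ⟨hs0, hs1⟩, hs⟩ := intermediate_value_Icc zero_le_one hcont
      (show ρ ∈ Icc ‖x + (0 : ℝ) • (y - x)‖ ‖x + (1 : ℝ) • (y - x)‖ by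
        simpa using ⟨hx, (not_le.1 hy).le⟩)
    simp only at hs
    have h1 := hg.dist_le_mul x (by simpa using hx) (x + s • (y - x)) (by simp [hs])
    rw [h0 _ hs] at h1
    refine h1.trans ?_
    gcongr
    rw [dist_eq_norm, dist_comm x y, dist_eq_norm]
    have : x - (x + s • (y - x)) = -(s • (y - x)) := by abel
    rw [this, norm_neg, norm_smul, Real.norm_eq_abs, abs_of_nonneg hs0]
    exact mul_le_of_le_one_left (norm_nonneg _) hs1
  refine LipschitzWith.of_dist_le_mul fun x y => ?_
  by_cases hx : x ∈ Metric.closedBall (0 : E) ρ <;> by_cases hy : y ∈ Metric.closedBall (0 : E) ρ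
  · simpa [indicator_of_mem, hx, hy] using hg.dist_le_mul x hx y hy
  · rw [indicator_of_mem hx, indicator_of_notMem hy]; exact key x hx y hy
  · rw [indicator_of_notMem hx, indicator_of_mem hy, dist_comm, dist_comm x]; exact key y hy x hx
  · rw [indicator_of_notMem hx, indicator_of_notMem hy, dist_self]; positivity

/-- A perturbation of the identity with small Lipschitz constant, that is the identity on the
boundary of a ball, maps the ball bijectively onto itself. -/
lemma bijOn_closedBall_add_smul [NormedSpace ℝ E] [CompleteSpace E] {g : E → E} {ρ t : ℝ} {C : ℝ≥0}
    (hg : LipschitzOnWith C g (Metric.closedBall 0 ρ)) (h0 : ∀ x, ‖x‖ = ρ → g x = 0)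
    (ht : 0 ≤ t) (htC : t * C < 1)
    (hmaps : MapsTo (fun x => x + t • g x) (Metric.closedBall 0 ρ) (Metric.closedBall 0 ρ)) :
    BijOn (fun x => x + t • g x) (Metric.closedBall 0 ρ) (Metric.closedBall 0 ρ) := by
  refine ⟨hmaps, fun x hx y hy hxy => ?_, fun y hy => ?_⟩
  · have h1 := hg.dist_le_mul x hx y hy
    have h2 : x - y = -(t • (g x - g y)) := by
      have : x + t • g x = y + t • g y := hxy
      rw [smul_sub, neg_sub, sub_eq_sub_iff_add_eq_add, this, add_comm]
    have h3 : dist x y ≤ t * C * dist x y := by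
      calc dist x y = t * dist (g x) (g y) := by
            rw [dist_eq_norm, h2, norm_neg, norm_smul, Real.norm_eq_abs, abs_of_nonneg ht,
              dist_eq_norm]
        _ ≤ t * (C * dist x y) := by gcongr
        _ = _ := by ring
    by_contra hne
    have := dist_pos.2 hne
    nlinarith
  · set G := (Metric.closedBall (0 : E) ρ).indicator g with hG
    -- The equation `x + t g(x) = y` is a fixed point problem for `x ↦ y - t G(x)`, a contraction of
    -- the whole space once `g` is extended by zero. A fixed point outside the ball would equal `y`,
    -- which lies inside.
    have hLip := lipschitzWith_indicator_closedBall hg h0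
    have hc : ContractingWith (t.toNNReal * C) (fun x => y - t • G x) := by
      refine ⟨?_, LipschitzWith.of_dist_le_mul fun a b => ?_⟩
      · rw [← NNReal.coe_lt_coe]; simpa [ht] using htC
      · have h1 := hLip.dist_le_mul a b
        rw [dist_sub_left, dist_eq_norm, ← smul_sub, norm_smul, Real.norm_eq_abs, abs_of_nonneg ht,
          ← dist_eq_norm]
        push_cast
        rw [Real.coe_toNNReal t ht, mul_assoc]
        gcongr
    have hfix : y - t • G (hc.fixedPoint _) = hc.fixedPoint _ := hc.fixedPoint_isFixedPt
    set x := hc.fixedPoint _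
    have hx : x ∈ Metric.closedBall (0 : E) ρ := by
      by_contra hx
      rw [hG, indicator_of_notMem hx, smul_zero, sub_zero] at hfix
      exact hx (hfix ▸ hy)
    refine ⟨x, hx, ?_⟩
    rw [hG, indicator_of_mem hx] at hfix
    simp only
    nth_rewrite 1 [← hfix]
    abel

/-- Interpolation weights that recover the value at `1` of a polynomial of degree at most `n` from
its values at small positive nodes. -/
lemma exists_extrapolation_weights (n : ℕ) {τ : ℝ} (hτ : 0 < τ) :
    ∃ (v w : ℕ → ℝ), (∀ i ∈ Finset.range (n + 1), 0 ≤ v i ∧ v i ≤ τ) ∧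
      ∑ i ∈ Finset.range (n + 1), w i = 1 ∧
      ∀ p : Polynomial ℝ, p.natDegree ≤ n →
        p.eval 1 = ∑ i ∈ Finset.range (n + 1), w i * p.eval (v i) := by
  classical
  have hn : (0 : ℝ) < n + 1 := by positivity
  let v : ℕ → ℝ := fun i => τ * (i / (n + 1))
  have hv : Set.InjOn v (Finset.range (n + 1)) := by
    intro i _ j _ hij
    have : (i : ℝ) / (n + 1) = j / (n + 1) := mul_left_cancel₀ hτ.ne' hij
    exact_mod_cast (div_left_inj' hn.ne').1 this
  -- The weights are the Lagrange basis polynomials at 1; they sum to 1 because the basis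
  -- polynomials do.
  refine ⟨v, fun i => (Lagrange.basis (Finset.range (n + 1)) v i).eval 1, fun i hi => ⟨?_, ?_⟩,
    ?_, fun p hp => ?_⟩
  · positivity
  · have : (i : ℝ) ≤ n := by exact_mod_cast Nat.lt_succ_iff.1 (Finset.mem_range.1 hi)
    refine mul_le_of_le_one_right hτ.le ((div_le_one hn).2 (by linarith))
  · rw [← Polynomial.eval_finsetSum, Lagrange.sum_basis hv (by simp), Polynomial.eval_one]
  · have hd : p.degree < (Finset.range (n + 1)).card := by
      rw [Finset.card_range]
      exact Polynomial.degree_le_natDegree.trans_lt (by exact_mod_cast Nat.lt_succ_of_le hp)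
    conv_lhs => rw [Lagrange.eq_interpolate hv hd, Lagrange.interpolate_apply]
    rw [Polynomial.eval_finsetSum]
    refine Finset.sum_congr rfl fun i _ => ?_
    rw [Polynomial.eval_mul, Polynomial.eval_C, mul_comm]

/-- `t ↦ det (1 + t A)` is a polynomial of degree at most the dimension. -/
lemma exists_polynomial_det_one_add_smul [NormedSpace ℝ E] [FiniteDimensional ℝ E] (A : E →L[ℝ] E) :
    ∃ p : Polynomial ℝ, p.natDegree ≤ Module.finrank ℝ E ∧
      ∀ t : ℝ, p.eval t = (ContinuousLinearMap.id ℝ E + t • A).det := by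
  classical
  let b := Module.finBasis ℝ E
  let M := LinearMap.toMatrix b b (A : E →ₗ[ℝ] E)
  refine ⟨((Polynomial.X : Polynomial ℝ) • M.map Polynomial.C +
    (1 : Matrix (Fin _) (Fin _) ℝ).map Polynomial.C).det, ?_, fun t => ?_⟩
  · simpa using Polynomial.natDegree_det_X_add_C_le M 1
  · change Polynomial.evalRingHom t _ = _
    rw [RingHom.map_det, ContinuousLinearMap.det,
      ← LinearMap.det_toMatrix b]
    congr 1
    have : LinearMap.toMatrix b b ((ContinuousLinearMap.id ℝ E + t • A : E →L[ℝ] E) : E →ₗ[ℝ] E)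
        = 1 + t • M := by
      rw [← LinearMap.toMatrix_id b, ← map_smul, ← map_add]
      rfl
    rw [this]
    ext i j
    by_cases hij : i = j <;> simp [hij, mul_comm _ t, add_comm (t * _)]

/-- `1 + A` has positive determinant if `A` is a strict contraction. -/
lemma det_id_add_pos [NormedSpace ℝ E] [FiniteDimensional ℝ E] (A : E →L[ℝ] E) (hA : ‖A‖ < 1) :
    0 < (ContinuousLinearMap.id ℝ E + A).det := by
  -- Along the path `1 + s A` injectivity persists, so the determinant never vanishes and keeps the
  -- sign it has at `s = 0`.
  have hne : ∀ s ∈ Icc (0 : ℝ) 1, (ContinuousLinearMap.id ℝ E + s • A).det ≠ 0 := by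
    intro s hs h
    have hinj : Function.Injective (ContinuousLinearMap.id ℝ E + s • A : E →L[ℝ] E) := by
      refine (injective_iff_map_eq_zero _).2 fun x hx => ?_
      by_contra hx0
      have h1 : ‖x‖ = ‖s • A x‖ := by
        rw [← norm_neg (s • A x)]
        congr 1
        exact eq_neg_of_add_eq_zero_left (by simpa using hx)
      have h2 : ‖s • A x‖ ≤ ‖A‖ * ‖x‖ := by
        rw [norm_smul, Real.norm_eq_abs, abs_of_nonneg hs.1]
        exact (mul_le_of_le_one_left (norm_nonneg _) hs.2).trans (A.le_opNorm x)
      have := norm_pos_iff.2 hx0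
      nlinarith
    have h2 : LinearMap.ker ((ContinuousLinearMap.id ℝ E + s • A : E →L[ℝ] E) : E →ₗ[ℝ] E) ≠ ⊥ :=
      ((LinearMap.det_eq_zero_iff_ker_ne_bot).1 h)
    exact h2 (LinearMap.ker_eq_bot.2 hinj)
  obtain ⟨p, -, hp⟩ := exists_polynomial_det_one_add_smul A
  by_contra! hneg
  have h0 : p.eval 0 = 1 := by rw [hp]; simp [ContinuousLinearMap.det]
  have h1 : p.eval 1 ≤ 0 := by rw [hp]; simpa using hneg
  obtain ⟨s, hs, hs'⟩ := intermediate_value_Icc' (f := fun t => p.eval t) zero_le_one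
    p.continuous.continuousOn (show (0 : ℝ) ∈ _ from ⟨h1, by simp [h0]⟩)
  exact hne s hs ((hp s).symm.trans hs')

/-- There is no `C¹` retraction of a ball onto its boundary sphere. -/
theorem not_exists_contDiff_retraction [InnerProductSpace ℝ E] [FiniteDimensional ℝ E]
    {r : E → E} {ρ : ℝ} (hρ : 0 < ρ) (hr : ContDiff ℝ 1 r) (hrρ : ∀ x, ‖r x‖ = ρ)
    (hid : ∀ x, ‖x‖ = ρ → r x = x) : False := by
  borelize E
  set B := Metric.closedBall (0 : E) ρ with hBdef
  have hBc : IsCompact B := isCompact_closedBall _ _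
  let g : E → E := fun x => r x - x
  have hg : ContDiff ℝ 1 g := hr.sub contDiff_id
  have hg0 : ∀ x, ‖x‖ = ρ → g x = 0 := fun x hx => by simp [g, hid x hx]
  have hcont : Continuous (fderiv ℝ g) := hg.continuous_fderiv one_ne_zero
  obtain ⟨C, hC⟩ := hBc.exists_bound_of_continuousOn hcont.continuousOn
  have hCn : ∀ x ∈ B, ‖fderiv ℝ g x‖₊ ≤ C.toNNReal := fun x hx => by
    rw [← NNReal.coe_le_coe, coe_nnnorm]
    exact (hC x hx).trans (Real.le_coe_toNNReal C)
  have hdiff : Differentiable ℝ g := hg.differentiable one_ne_zero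
  have hLip : LipschitzOnWith C.toNNReal g B :=
    (convex_closedBall (0 : E) ρ).lipschitzOnWith_of_nnnorm_fderiv_le (fun x _ => hdiff x) hCn
  set C' : ℝ≥0 := C.toNNReal
  -- For `t` up to this bound both `t ≤ 1` and `t C' < 1` hold.
  have hτ : (0 : ℝ) < min 1 (1 / (C' + 1)) / 2 := by positivity
  obtain ⟨v, w, hv, hw, hpoly⟩ := exists_extrapolation_weights (Module.finrank ℝ E) hτ
  let D : ℝ → E → ℝ := fun t x => (ContinuousLinearMap.id ℝ E + t • fderiv ℝ g x).det
  have hDcont : ∀ t, Continuous (D t) := fun t =>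
    ContinuousLinearMap.continuous_det.comp (by fun_prop)
  have hint : ∀ t, IntegrableOn (D t) B volume := fun t =>
    (hDcont t).continuousOn.integrableOn_compact hBc
  -- For small `t` the map `x + t g(x)`, which moves from the identity towards `r`, is a bijection
  -- of the ball with positive Jacobian, so the integral of the Jacobian is the volume of the ball.
  have hsmall : ∀ t, 0 ≤ t → t ≤ min 1 (1 / ((C' : ℝ) + 1)) / 2 →
      ∫ x in B, D t x = (volume B).toReal := by
    intro t ht0 ht
    have ht1 : t ≤ 1 := by
      have := min_le_left 1 (1 / ((C' : ℝ) + 1)); linarith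
    have htC : t * C' < 1 := by
      have h1 := min_le_right 1 (1 / ((C' : ℝ) + 1))
      have h2 : (0 : ℝ) < C' + 1 := by positivity
      have h3 : t < 1 / ((C' : ℝ) + 1) := by
        have : 0 < 1 / ((C' : ℝ) + 1) := by positivity
        linarith
      rw [lt_div_iff₀ h2] at h3
      nlinarith
    have hmaps : MapsTo (fun x => x + t • g x) B B := by
      intro x hx
      rw [hBdef, mem_closedBall_zero_iff] at hx ⊢
      have : x + t • g x = (1 - t) • x + t • r x := by
        simp only [g, smul_sub, sub_smul, one_smul]; abel
      simp only [this]
      refine (norm_add_le _ _).trans ?_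
      rw [norm_smul, norm_smul, hrρ, Real.norm_eq_abs, Real.norm_eq_abs, abs_of_nonneg ht0,
        abs_of_nonneg (by linarith)]
      nlinarith
    have hbij := bijOn_closedBall_add_smul hLip hg0 ht0 htC hmaps
    have hcv := integral_image_eq_integral_abs_det_fderiv_smul (volume : Measure E)
      (f := fun x => x + t • g x) (f' := fun x => ContinuousLinearMap.id ℝ E + t • fderiv ℝ g x)
      measurableSet_closedBall
      (fun x _ => ((hasFDerivAt_id x).add
        ((hdiff x).hasFDerivAt.const_smul t)).hasFDerivWithinAt) hbij.injOn (fun _ => (1 : ℝ))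
    rw [hbij.image_eq] at hcv
    have h1 : ∫ x in B, D t x = ∫ x in B, |D t x| • (1 : ℝ) := by
      refine setIntegral_congr_fun measurableSet_closedBall fun x hx => ?_
      have hpos : 0 < D t x := by
        refine det_id_add_pos _ ?_
        rw [norm_smul, Real.norm_eq_abs, abs_of_nonneg ht0]
        have : ‖fderiv ℝ g x‖ ≤ C' := hCn x hx
        exact (mul_le_mul_of_nonneg_left this ht0).trans_lt htC
      simp [abs_of_pos hpos]
    rw [h1, ← hcv]
    simp [Measure.real, hBdef]
  -- The Jacobian is a polynomial in `t` whose degree is bounded independently of `x`, so one set of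
  -- weights extrapolates it from small `t` to `t = 1` at all points simultaneously.
  have hone : ∫ x in B, D 1 x = (volume B).toReal := by
    have h1 : ∀ x, D 1 x = ∑ i ∈ Finset.range (Module.finrank ℝ E + 1), w i * D (v i) x := by
      intro x
      obtain ⟨p, hp, hp'⟩ := exists_polynomial_det_one_add_smul (fderiv ℝ g x)
      have := hpoly p hp
      simpa only [hp'] using this
    simp_rw [h1]
    rw [integral_finsetSum _ fun i _ => (hint (v i)).const_mul (w i)]
    simp_rw [integral_const_mul]
    rw [Finset.sum_congr rfl fun i hi => by rw [hsmall (v i) (hv i hi).1 (hv i hi).2],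
      ← Finset.sum_mul, hw, one_mul]
  -- At `t = 1` the Jacobian is that of `r`. Since `‖r‖²` is constant, `r x` is orthogonal to the
  -- range of the derivative, which is therefore not surjective. This contradicts `hone`.
  have hzero : ∀ x, D 1 x = 0 := by
    intro x
    have hrx : HasFDerivAt r (ContinuousLinearMap.id ℝ E + (1 : ℝ) • fderiv ℝ g x) x := by
      have := (hasFDerivAt_id x).add ((hdiff x).hasFDerivAt)
      rw [one_smul]
      refine this.congr_of_eventuallyEq (Eventually.of_forall fun y => ?_)
      simp [g]
    by_contra hne
    set R := ContinuousLinearMap.id ℝ E + (1 : ℝ) • fderiv ℝ g x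
    have hsurj : Function.Surjective R := by
      have hinj : LinearMap.ker (R : E →ₗ[ℝ] E) = ⊥ := by
        by_contra h
        exact hne (LinearMap.det_eq_zero_iff_ker_ne_bot.2 h)
      exact LinearMap.injective_iff_surjective.1 (LinearMap.ker_eq_bot.1 hinj)
    obtain ⟨u, hu⟩ := hsurj (r x)
    have hns := hrx.norm_sq
    have hconst : (fun y => ‖r y‖ ^ 2) = fun _ => ρ ^ 2 := by ext y; rw [hrρ]
    rw [hconst] at hns
    have := congrArg (fun T => T u) (hns.unique (hasFDerivAt_const (ρ ^ 2) x))
    simp [hu, hrρ] at this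
    exact hρ.ne' this
  have hvol : 0 < (volume B).toReal :=
    ENNReal.toReal_pos (Metric.measure_closedBall_pos volume 0 hρ).ne' hBc.measure_lt_top.ne
  simp only [hzero, integral_zero] at hone
  exact hvol.ne hone

/-- A bounded `C¹` self-map of a finite-dimensional Euclidean space has a fixed point. -/
theorem exists_fixedPoint_of_contDiff [InnerProductSpace ℝ E] [FiniteDimensional ℝ E]
    {f : E → E} {R : ℝ} (hf : ContDiff ℝ 1 f) (hR : ∀ x, ‖f x‖ ≤ R) : ∃ x, f x = x := by
  by_contra! hne
  have hR0 : 0 ≤ R := (norm_nonneg _).trans (hR 0)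
  -- The cut-off leaves `f` unchanged where a fixed point of `χ f` could lie and makes `N` the
  -- identity on the sphere of radius `R + 2`; normalising `N` then gives a forbidden retraction.
  let χ : ContDiffBump (0 : E) := ⟨R + 1, R + 2, by linarith, by linarith⟩
  let N : E → E := fun x => x - χ x • f x
  have hN : ∀ x, N x ≠ 0 := by
    intro x hx
    have hx' : x = χ x • f x := sub_eq_zero.1 hx
    by_cases h : x ∈ Metric.closedBall (0 : E) (R + 1)
    · rw [χ.one_of_mem_closedBall h, one_smul] at hx'
      exact hne x hx'.symm
    · rw [mem_closedBall_zero_iff, not_le] at h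
      have : ‖x‖ ≤ R := by
        rw [hx', norm_smul, Real.norm_eq_abs, abs_of_nonneg χ.nonneg]
        exact (mul_le_of_le_one_left (norm_nonneg _) χ.le_one).trans (hR x)
      linarith
  have hNid : ∀ x, ‖x‖ = R + 2 → N x = x := by
    intro x hx
    have : χ x = 0 := χ.zero_of_le_dist (by simp [hx, χ])
    simp [N, this]
  have hNc : ContDiff ℝ 1 N := contDiff_id.sub (χ.contDiff.smul hf)
  refine not_exists_contDiff_retraction (r := fun x => ((R + 2) * ‖N x‖⁻¹) • N x) (ρ := R + 2)
    (by linarith) ?_ (fun x => ?_) fun x hx => ?_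
  · exact (contDiff_const.mul ((hNc.norm ℝ hN).inv fun x => norm_ne_zero_iff.2 (hN x))).smul hNc
  · rw [norm_smul, norm_mul, norm_inv, norm_norm, mul_assoc,
      inv_mul_cancel₀ (norm_ne_zero_iff.2 (hN x)), mul_one, Real.norm_eq_abs,
      abs_of_nonneg (by linarith)]
  · rw [hNid x hx, hx, mul_inv_cancel₀ (by linarith), one_smul]

/-- A bounded uniformly continuous self-map of a finite-dimensional Euclidean space has a fixed
point. -/
theorem exists_fixedPoint_of_uniformContinuous [InnerProductSpace ℝ E] [FiniteDimensional ℝ E]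
    {f : E → E} {R : ℝ} (hf : UniformContinuous f) (hR : ∀ x, ‖f x‖ ≤ R) : ∃ x, f x = x := by
  by_contra! hne
  have hR0 : 0 ≤ R := (norm_nonneg _).trans (hR 0)
  -- Without a fixed point the displacement has a positive minimum on the ball of radius `R + 1`. A
  -- smooth approximation closer than this minimum, and closer than 1, has its fixed point in that
  -- ball.
  obtain ⟨x₀, -, hx₀⟩ := (isCompact_closedBall (0 : E) (R + 1)).exists_isMinOn
    ⟨0, by simp; linarith⟩ (f := fun x => dist (f x) x)
    (hf.continuous.dist continuous_id).continuousOn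
  have hm : 0 < dist (f x₀) x₀ := dist_pos.2 (hne x₀)
  obtain ⟨g, hg, hgf⟩ := hf.exists_contDiff_dist_le (lt_min hm one_pos)
  have hgR : ∀ x, ‖g x‖ ≤ R + 1 := fun x => by
    have h1 := (hgf x).le.trans (min_le_right _ _)
    rw [dist_eq_norm] at h1
    have h2 := norm_add_le (g x - f x) (f x)
    rw [sub_add_cancel] at h2
    linarith [hR x]
  obtain ⟨x, hx⟩ := exists_fixedPoint_of_contDiff (hg.of_le (by exact_mod_cast le_top)) hgR
  have hmin : dist (f x₀) x₀ ≤ dist (f x) x := hx₀ (by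
    rw [mem_closedBall_zero_iff, ← hx]; exact hgR x)
  have h2 := (hgf x).trans_le (min_le_left _ _)
  rw [hx, dist_comm] at h2
  linarith

/-- A bounded Lipschitz self-map of a finite-dimensional normed space has a fixed point. -/
theorem exists_fixedPoint_of_lipschitz [NormedSpace ℝ E] [FiniteDimensional ℝ E]
    {f : E → E} {R : ℝ} {C : ℝ≥0} (hf : LipschitzWith C f) (hR : ∀ x, ‖f x‖ ≤ R) :
    ∃ x, f x = x := by
  let e : E ≃L[ℝ] EuclideanSpace ℝ (Fin (Module.finrank ℝ E)) :=
    ContinuousLinearEquiv.ofFinrankEq (by simp)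
  obtain ⟨x, hx⟩ := exists_fixedPoint_of_uniformContinuous
    (f := fun x => e (f (e.symm x))) (R := ‖e.toContinuousLinearMap‖ * R)
    (e.toContinuousLinearMap.uniformContinuous.comp
      (hf.uniformContinuous.comp e.symm.toContinuousLinearMap.uniformContinuous))
    (fun x => (e.toContinuousLinearMap.le_opNorm _).trans
      (mul_le_mul_of_nonneg_left (hR _) (norm_nonneg _)))
  exact ⟨e.symm x, by rw [e.eq_symm_apply]; exact hx⟩

end Brouwer

/-! ### Quasilinear problems with a coercive family of forms -/

section Abstract

variable {E : Type*} [NormedAddCommGroup E] [NormedSpace ℂ E]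

/-- A family of sesquilinear forms that is uniformly coercive on `W`, uniformly bounded, and
Lipschitz with respect to the parameter. -/
structure IsCoerciveFamily (W : Submodule ℂ E) (a : E → E →ₗ[ℂ] E →ₗ⋆[ℂ] ℂ) (κ M L : ℝ) : Prop where
  pos : 0 < κ
  bound_nonneg : 0 ≤ M
  lip_nonneg : 0 ≤ L
  coercive : ∀ c, ∀ w ∈ W, κ * ‖w‖ ^ 2 ≤ ‖a c w w‖
  bound : ∀ c u w, ‖a c u w‖ ≤ M * ‖u‖ * ‖w‖
  lip : ∀ c c' u w, ‖a c u w - a c' u w‖ ≤ L * ‖c - c'‖ * ‖u‖ * ‖w‖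

/-- `u` has boundary values `z` (modulo `W`) and solves the linear problem with parameter `c`. -/
def IsLinearSolution (W : Submodule ℂ E) (a : E → E →ₗ[ℂ] E →ₗ⋆[ℂ] ℂ) (l : E →ₗ⋆[ℂ] ℂ)
    (z c u : E) : Prop :=
  u - z ∈ W ∧ ∀ w ∈ W, a c u w = l w

variable {W : Submodule ℂ E} {a : E → E →ₗ[ℂ] E →ₗ⋆[ℂ] ℂ} {κ M L : ℝ} {l : E →ₗ⋆[ℂ] ℂ} {z : E}

lemma IsCoerciveFamily.norm_le (h : IsCoerciveFamily W a κ M L) {c w : E} (hw : w ∈ W) {D : ℝ}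
    (hD : 0 ≤ D) (hle : ‖a c w w‖ ≤ D * ‖w‖) : ‖w‖ ≤ D / κ := by
  rw [le_div_iff₀ h.pos]
  have h1 := h.coercive c w hw
  rcases (norm_nonneg w).eq_or_lt with h0 | h0
  · rw [← h0]; simpa using hD
  · nlinarith

/-- Testing against a basis of `W` turns the problem into a square linear system for the correction
to `z`; coercivity makes it injective, hence surjective. -/
lemma IsCoerciveFamily.existsUnique (h : IsCoerciveFamily W a κ M L) [FiniteDimensional ℂ E]
    (l : E →ₗ⋆[ℂ] ℂ) (z c : E) : ∃! u, IsLinearSolution W a l z c u := by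
  let b := Module.finBasis ℂ W
  have hext : ∀ φ : E →ₗ⋆[ℂ] ℂ, (∀ i, φ (b i) = 0) → ∀ w ∈ W, φ w = 0 := by
    intro φ hφ w hw
    have h1 := b.sum_repr ⟨w, hw⟩
    have h2 : w = ∑ i, b.repr ⟨w, hw⟩ i • (b i : E) := by
      have := congrArg W.subtype h1.symm
      rw [map_sum] at this
      exact this
    rw [h2, map_sum]
    exact Finset.sum_eq_zero fun i _ => by rw [LinearMap.map_smulₛₗ, hφ, smul_zero]
  let T : W →ₗ[ℂ] (Fin (Module.finrank ℂ W) → ℂ) :=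
    { toFun := fun v i => a c v (b i)
      map_add' := fun v v' => by ext i; simp
      map_smul' := fun k v => by ext i; simp }
  have hker : ∀ v ∈ W, (∀ w ∈ W, a c v w = 0) → v = 0 := by
    intro v hv hv0
    have := h.norm_le hv (c := c) le_rfl (by simp [hv0 v hv])
    simpa using this
  have hinj : Function.Injective T := by
    refine (injective_iff_map_eq_zero T).2 fun v hv => ?_
    exact Subtype.ext (hker v v.2 (hext (a c v) fun i => congrFun hv i))
  have hsurj : Function.Surjective T :=
    (LinearMap.injective_iff_surjective_of_finrank_eq_finrank (by simp)).1 hinj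
  obtain ⟨v, hv⟩ := hsurj fun i => l (b i) - a c z (b i)
  refine ⟨z + v, ⟨by simp, fun w hw => ?_⟩, fun u hu => ?_⟩
  · have := hext (a c (z + v) - l) (fun i => by
      have := congrFun hv i
      simp only [T, LinearMap.coe_mk, AddHom.coe_mk] at this
      simp [this]) w hw
    simpa [sub_eq_zero] using this
  · have h1 : u - (z + v) ∈ W := by
      rw [← sub_sub]; exact W.sub_mem hu.1 v.2
    refine sub_eq_zero.1 (hker _ h1 fun w hw => ?_)
    have := hext (a c (z + v) - l) (fun i => by
      have := congrFun hv i
      simp only [T, LinearMap.coe_mk, AddHom.coe_mk] at this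
      simp [this]) w hw
    rw [LinearMap.sub_apply, sub_eq_zero] at this
    rw [map_sub, LinearMap.sub_apply, hu.2 w hw, this, sub_self]

/-- The test function is `u - z`. The bound does not involve `c`, so the solution map is bounded on
the whole space. -/
lemma IsCoerciveFamily.norm_le_of_isLinearSolution (h : IsCoerciveFamily W a κ M L) {c u : E}
    {Λ : ℝ} (hΛ : 0 ≤ Λ) (hl : ∀ w, ‖l w‖ ≤ Λ * ‖w‖) (hu : IsLinearSolution W a l z c u) :
    ‖u‖ ≤ ‖z‖ + (Λ + M * ‖z‖) / κ := by
  have h1 : ‖u - z‖ ≤ (Λ + M * ‖z‖) / κ := by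
    refine h.norm_le hu.1 (c := c) (by have := h.bound_nonneg; positivity) ?_
    have : a c (u - z) (u - z) = l (u - z) - a c z (u - z) := by
      rw [(a c).map_sub u z, LinearMap.sub_apply, hu.2 _ hu.1]
    rw [this, add_mul]
    exact (norm_sub_le _ _).trans (add_le_add (hl _) (h.bound _ _ _))
  calc ‖u‖ = ‖z + (u - z)‖ := by rw [add_sub_cancel]
    _ ≤ _ := (norm_add_le _ _).trans (by gcongr)

/-- The boundary values cancel in `u - u'`, which is thus an admissible test function; the common
load cancels too, leaving only the change of the form applied to `u'`. -/
lemma IsCoerciveFamily.norm_sub_le (h : IsCoerciveFamily W a κ M L) {c c' u u' : E}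
    (hu : IsLinearSolution W a l z c u) (hu' : IsLinearSolution W a l z c' u') :
    ‖u - u'‖ ≤ L * ‖u'‖ / κ * ‖c - c'‖ := by
  have hmem : u - u' ∈ W := by
    have := W.sub_mem hu.1 hu'.1
    rwa [sub_sub_sub_cancel_right] at this
  have h1 : ‖u - u'‖ ≤ (L * ‖c' - c‖ * ‖u'‖) / κ := by
    refine h.norm_le hmem (c := c) (by have := h.lip_nonneg; positivity) ?_
    have : a c (u - u') (u - u') = a c' u' (u - u') - a c u' (u - u') := by
      rw [(a c).map_sub u u', LinearMap.sub_apply, hu.2 _ hmem, hu'.2 _ hmem]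
    rw [this]
    exact h.lip _ _ _ _
  rw [norm_sub_rev c c']
  exact h1.trans_eq (by ring)

lemma IsCoerciveFamily.exists_fixedPoint (h : IsCoerciveFamily W a κ M L) [FiniteDimensional ℂ E]
    {Λ : ℝ} (hΛ : 0 ≤ Λ) (hl : ∀ w, ‖l w‖ ≤ Λ * ‖w‖) (z : E) :
    ∃ u, IsLinearSolution W a l z u u := by
  -- The solution map is defined for every `c`, not only for those with the right boundary values,
  -- so Brouwer applies on the full space; a fixed point acquires the boundary values as a value of
  -- `T`.
  choose T hT _ using fun c => h.existsUnique l z c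
  set S := ‖z‖ + (Λ + M * ‖z‖) / κ
  have hS : ∀ c, ‖T c‖ ≤ S := fun c => h.norm_le_of_isLinearSolution hΛ hl (hT c)
  let : NormedSpace ℝ E := NormedSpace.restrictScalars ℝ ℂ E
  have : FiniteDimensional ℝ E := FiniteDimensional.complexToReal E
  have hLip : LipschitzWith (L * S / κ).toNNReal T := by
    refine LipschitzWith.of_dist_le_mul fun c c' => ?_
    rw [dist_eq_norm, dist_eq_norm]
    refine (h.norm_sub_le (hT c) (hT c')).trans ?_
    refine mul_le_mul_of_nonneg_right (le_trans ?_ (Real.le_coe_toNNReal _)) (norm_nonneg _)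
    have := h.pos
    have := h.lip_nonneg
    gcongr
    exact hS c'
  obtain ⟨u, hu⟩ := exists_fixedPoint_of_lipschitz hLip hS
  exact ⟨u, by simpa only [hu] using hT u⟩

lemma IsCoerciveFamily.eq_of_fixedPoint (h : IsCoerciveFamily W a κ M L) {u u' : E} {Λ : ℝ}
    (hΛ : 0 ≤ Λ) (hl : ∀ w, ‖l w‖ ≤ Λ * ‖w‖)
    (hsmall : L * (‖z‖ + (Λ + M * ‖z‖) / κ) / κ < 1)
    (hu : IsLinearSolution W a l z u u) (hu' : IsLinearSolution W a l z u' u') : u = u' := by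
  have h1 := h.norm_sub_le hu hu'
  have h2 := h.norm_le_of_isLinearSolution hΛ hl hu'
  have h3 : L * ‖u'‖ / κ < 1 := lt_of_le_of_lt (by
    have := h.pos
    have := h.lip_nonneg
    gcongr) hsmall
  by_contra hne
  have := norm_pos_iff.2 (sub_ne_zero.2 hne)
  nlinarith

end Abstract

/-! ### Lipschitz continuity of the cut-off coefficients -/

section Coefficients

lemma cutoff_eq_comp_clamp {ξm ξp : ℝ} (h : ξm ≤ ξp) (G : ℝ → ℝ) (s : ℝ) :
    cutoff ξm ξp G s = G (max ξm (min s ξp)) := by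
  unfold cutoff
  split_ifs with h1 h2
  · rw [min_eq_right h1, max_eq_right h]
  · rw [min_eq_left (not_le.1 h1).le, max_eq_left h2]
  · rw [min_eq_left (not_le.1 h1).le, max_eq_right (not_le.1 h2).le]

/-- A bounded quotient of smooth functions with no common zero has no pole, if the zeros of the
denominator are simple. -/
lemma denominator_ne_zero {ξm ξp M s : ℝ} {p q : ℝ → ℝ} {q' : ℝ} (hlt : ξm < ξp)
    (hs : s ∈ Icc ξm ξp) (hp : ContinuousAt p s) (hq : HasDerivAt q q' s)
    (hpq : q s = 0 → p s ≠ 0 ∧ q' ≠ 0)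
    (hM : ∀ t ∈ Ioo ξm ξp, |p t / q t| ≤ M) : q s ≠ 0 := by
  intro h0
  obtain ⟨hps, hq'⟩ := hpq h0
  -- The point `s` may be an end point of the interval, hence only frequently; this is enough to
  -- pass to the limit in `|p| ≤ M |q|`, which then forces `p s = 0`.
  have hfreq : ∃ᶠ t in 𝓝[≠] s, t ∈ Ioo ξm ξp := by
    rcases hs.2.lt_or_eq with h | h
    · have h1 : ∀ᶠ t in 𝓝[>] s, t ∈ Ioo ξm ξp := by
        filter_upwards [Ioo_mem_nhdsGT h] with t ht
        exact ⟨hs.1.trans_lt ht.1, ht.2⟩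
      exact h1.frequently.filter_mono (nhdsWithin_mono _ fun t ht => ne_of_gt ht)
    · have h1 : ∀ᶠ t in 𝓝[<] s, t ∈ Ioo ξm ξp := by
        filter_upwards [Ioo_mem_nhdsLT (h ▸ hlt)] with t ht
        exact ⟨ht.1, h ▸ ht.2⟩
      exact h1.frequently.filter_mono (nhdsWithin_mono _ fun t ht => ne_of_lt ht)
  have hne : ∀ᶠ t in 𝓝[≠] s, q t ≠ 0 := by
    have := hq.eventually_ne hq' (c := 0)
    exact this
  have hle : ∃ᶠ t in 𝓝[≠] s, |p t| - M * |q t| ≤ 0 := by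
    refine (hfreq.and_eventually hne).mono fun t ⟨ht, hqt⟩ => ?_
    have := hM t ht
    rw [abs_div, div_le_iff₀ (abs_pos.2 hqt)] at this
    linarith
  have hlim : Tendsto (fun t => |p t| - M * |q t|) (𝓝[≠] s) (𝓝 (|p s| - M * |q s|)) :=
    (hp.abs.sub (hq.continuousAt.abs.const_mul M)).tendsto.mono_left nhdsWithin_le_nhds
  have := le_of_tendsto_of_frequently hlim hle
  rw [h0, abs_zero, mul_zero, sub_zero] at this
  exact hps (abs_nonpos_iff.1 this)

lemma hasDerivAt_mu1 (α s : ℝ) : HasDerivAt (mu1 α) (-Real.sin s - α * Real.cos s) s :=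
  (Real.hasDerivAt_cos s).sub ((Real.hasDerivAt_sin s).const_mul α)

lemma hasDerivAt_mu2 (β s : ℝ) : HasDerivAt (mu2 β) (-Real.sin s + β * Real.cos s) s :=
  (Real.hasDerivAt_cos s).add ((Real.hasDerivAt_sin s).const_mul β)

variable {α β ξm ξp : ℝ}

/-- The bounded cut-off coefficients are Lipschitz. -/
lemma exists_lipschitz_cutoff_div {p q q' : ℝ → ℝ} {M : ℝ} (hle : ξm ≤ ξp)
    (hp : ContDiff ℝ 1 p) (hq : ContDiff ℝ 1 q) (hq' : ∀ s, HasDerivAt q (q' s) s)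
    (hne : ξm = ξp → q ξm ≠ 0)
    (hpq : ∀ s ∈ Icc ξm ξp, q s = 0 → p s ≠ 0 ∧ q' s ≠ 0)
    (hM : ∀ t, |cutoff ξm ξp (fun s => p s / q s) t| ≤ M) :
    ∃ C : ℝ≥0, LipschitzWith C (cutoff ξm ξp fun s => p s / q s) := by
  have hq0 : ∀ s ∈ Icc ξm ξp, q s ≠ 0 := by
    -- For `ξm = ξp` boundedness carries no information, since the value `x / 0 = 0` hides a pole at
    -- a single point; `hne` covers this case.
    rcases hle.eq_or_lt with heq | hlt
    · intro s hs
      rw [← heq, Icc_self] at hs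
      rw [mem_singleton_iff.1 hs]
      exact hne heq
    · intro s hs
      refine denominator_ne_zero hlt hs hp.continuous.continuousAt (hq' s) (hpq s hs)
        (M := M) fun t ht => ?_
      have := hM t
      rwa [cutoff_eq_comp_clamp hle, min_eq_left ht.2.le, max_eq_right ht.1.le] at this
  have hcd : ContDiffOn ℝ 1 (fun s => p s / q s) (Icc ξm ξp) :=
    hp.contDiffOn.div hq.contDiffOn hq0
  obtain ⟨C, hC⟩ := hcd.exists_lipschitzOnWith one_ne_zero (convex_Icc _ _) isCompact_Icc
  refine ⟨C, LipschitzWith.of_dist_le_mul fun s t => ?_⟩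
  rw [cutoff_eq_comp_clamp hle, cutoff_eq_comp_clamp hle]
  refine (hC.dist_le_mul _ ⟨le_max_left _ _, max_le hle (min_le_right _ _)⟩ _
    ⟨le_max_left _ _, max_le hle (min_le_right _ _)⟩).trans ?_
  gcongr
  have h1 : LipschitzWith 1 fun s : ℝ => max ξm (min s ξp) :=
    (LipschitzWith.id.min_const ξp).const_max ξm
  simpa using h1.dist_le_mul s t

/-- Here `cos s ≥ 0`. A common zero would give `sin s = β cos s ≥ 0` and `cos s = α sin s ≤ 0`, so
both would vanish. Simplicity of the zero holds because `cos s = α sin s` and `sin s = -α cos s` are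
incompatible. -/
lemma deriv_mu2_ne_zero_of_mu1_eq_zero (hα : α ≤ 0) (hβ : 0 ≤ β) {s : ℝ}
    (hs : s ∈ Icc (-(Real.pi / 2)) (Real.pi / 2)) (h0 : mu1 α s = 0) :
    deriv (mu2 β) s ≠ 0 ∧ -Real.sin s - α * Real.cos s ≠ 0 := by
  have hcos := Real.cos_nonneg_of_mem_Icc hs
  have hsq := Real.sin_sq_add_cos_sq s
  have h0' : Real.cos s = α * Real.sin s := sub_eq_zero.1 h0
  rw [(hasDerivAt_mu2 β s).deriv]
  refine ⟨fun h => ?_, fun h => ?_⟩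
  · have h1 : Real.sin s = β * Real.cos s := by linarith
    have h2 : 0 ≤ Real.sin s := h1 ▸ mul_nonneg hβ hcos
    have h3 : Real.cos s = 0 := le_antisymm (h0' ▸ mul_nonpos_of_nonpos_of_nonneg hα h2) hcos
    rw [h1, h3] at hsq
    norm_num at hsq
  · have h1 : Real.sin s * (1 + α ^ 2) = 0 := by rw [h0'] at h; linarith
    have h2 : Real.sin s = 0 := (mul_eq_zero.1 h1).resolve_right (by positivity)
    rw [h0', h2] at hsq
    norm_num at hsq

lemma deriv_mu1_ne_zero_of_mu2_eq_zero (hα : α ≤ 0) (hβ : 0 ≤ β) {s : ℝ}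
    (hs : s ∈ Icc (-(Real.pi / 2)) (Real.pi / 2)) (h0 : mu2 β s = 0) :
    -deriv (mu1 α) s ≠ 0 ∧ -Real.sin s + β * Real.cos s ≠ 0 := by
  have hcos := Real.cos_nonneg_of_mem_Icc hs
  have hsq := Real.sin_sq_add_cos_sq s
  have h0' : Real.cos s = -β * Real.sin s := by
    linarith [show Real.cos s + β * Real.sin s = 0 from h0]
  rw [(hasDerivAt_mu1 α s).deriv]
  refine ⟨fun h => ?_, fun h => ?_⟩
  · have h1 : Real.sin s = -α * Real.cos s := by linarith
    have h2 : 0 ≤ Real.sin s := h1 ▸ mul_nonneg (neg_nonneg.2 hα) hcos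
    have h3 : Real.cos s = 0 :=
      le_antisymm (h0' ▸ mul_nonpos_of_nonpos_of_nonneg (neg_nonpos.2 hβ) h2) hcos
    rw [h1, h3] at hsq
    norm_num at hsq
  · have h1 : Real.sin s * (1 + β ^ 2) = 0 := by rw [h0'] at h; linarith
    have h2 : Real.sin s = 0 := (mul_eq_zero.1 h1).resolve_right (by positivity)
    rw [h0', h2] at hsq
    norm_num at hsq

lemma contDiff_mu1 (α : ℝ) : ContDiff ℝ 1 (mu1 α) :=
  Real.contDiff_cos.sub (contDiff_const.mul Real.contDiff_sin)

lemma contDiff_mu2 (β : ℝ) : ContDiff ℝ 1 (mu2 β) :=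
  Real.contDiff_cos.add (contDiff_const.mul Real.contDiff_sin)

lemma contDiff_deriv_mu1 (α : ℝ) : ContDiff ℝ 1 (deriv (mu1 α)) := by
  rw [funext fun s => (hasDerivAt_mu1 α s).deriv]
  exact Real.contDiff_sin.neg.sub (contDiff_const.mul Real.contDiff_cos)

lemma contDiff_deriv_mu2 (β : ℝ) : ContDiff ℝ 1 (deriv (mu2 β)) := by
  rw [funext fun s => (hasDerivAt_mu2 β s).deriv]
  exact Real.contDiff_sin.neg.add (contDiff_const.mul Real.contDiff_cos)

/-- The diagonal entries of the cut-off coefficient matrix are Lipschitz. -/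
lemma exists_lipschitz_Bhat (hα : α ≤ 0) (hβ : 0 ≤ β)
    (hξm : ξm ∈ Icc (-(Real.pi / 2)) 0) (hξp : ξp ∈ Icc 0 (Real.pi / 2))
    (hB : ∃ M > 0, ∀ (s : ℝ) (i j : Fin 2), |Bhat α β ξm ξp s i j| ≤ M) :
    ∃ C : ℝ≥0, ∀ i, LipschitzWith C fun s => Bhat α β ξm ξp s i i := by
  obtain ⟨M, -, hM⟩ := hB
  have hle : ξm ≤ ξp := hξm.2.trans hξp.1
  have hsub : Icc ξm ξp ⊆ Icc (-(Real.pi / 2)) (Real.pi / 2) := Icc_subset_Icc hξm.1 hξp.2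
  have h0 : ξm = ξp → ξm = 0 := fun h => le_antisymm hξm.2 (h ▸ hξp.1)
  obtain ⟨C₁, hC₁⟩ := exists_lipschitz_cutoff_div (M := M) hle (contDiff_deriv_mu2 β)
    (contDiff_mu1 α) (hasDerivAt_mu1 α) (fun h => by simp [h0 h, mu1])
    (fun s hs => deriv_mu2_ne_zero_of_mu1_eq_zero hα hβ (hsub hs))
    (fun t => by
      have : |cutoff ξm ξp (Gamma21 α β) t| ≤ M := by simpa [Bhat] using hM t 0 0
      exact this)
  obtain ⟨C₂, hC₂⟩ := exists_lipschitz_cutoff_div (M := M) hle (contDiff_deriv_mu1 α).neg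
    (contDiff_mu2 β) (hasDerivAt_mu2 β) (fun h => by simp [h0 h, mu2])
    (fun s hs => deriv_mu1_ne_zero_of_mu2_eq_zero hα hβ (hsub hs))
    (fun t => by
      have : |cutoff ξm ξp (Gamma12 α β) t| ≤ M := by simpa [Bhat] using hM t 1 1
      exact this)
  refine ⟨max C₁ C₂, fun i => ?_⟩
  fin_cases i
  · exact hC₁.neg.weaken (le_max_left _ _)
  · exact hC₂.weaken (le_max_right _ _)

end Coefficients

/-! ### Piecewise affine functions and their vertex values -/

section Triangulation

/-- The triangles of a mesh. -/
abbrev Tri (K : Mesh) : Type := {t : Finset Plane // t ∈ K.faces ∧ t.card = 3}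

/-- The closed triangle spanned by the vertices. -/
def Tri.hull {K : Mesh} (t : Tri K) : Set Plane := convexHull ℝ (t.1 : Set Plane)

/-- The vertices of a triangle as an affine basis of the plane. -/
def Tri.basis {K : Mesh} (t : Tri K) : AffineBasis t.1 ℝ Plane where
  toFun := (↑)
  ind' := K.indep t.2.1
  tot' := (K.indep t.2.1).affineSpan_eq_top_iff_card_eq_finrank_add_one.2 (by simp [t.2.2])

variable {K : Mesh} {Ω ΓD : Set Plane} {𝕜 : Type} [RCLike 𝕜]

@[simp] lemma Tri.basis_apply (t : Tri K) (a : t.1) : t.basis a = a := rfl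

lemma Tri.range_basis (t : Tri K) : range t.basis = (t.1 : Set Plane) := by
  ext x; simp [Set.mem_range]

lemma Tri.hull_eq (t : Tri K) : t.hull = {x | ∀ a, 0 ≤ t.basis.coord a x} := by
  rw [← t.basis.convexHull_eq_nonneg_coord, t.range_basis, Tri.hull]

lemma Tri.interior_hull_eq (t : Tri K) : interior t.hull = {x | ∀ a, 0 < t.basis.coord a x} := by
  rw [← t.basis.interior_convexHull, t.range_basis, Tri.hull]

lemma Tri.isClosed_hull (t : Tri K) : IsClosed t.hull :=
  (t.1.finite_toSet.isCompact_convexHull ℝ).isClosed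

lemma Tri.hull_subset_space (t : Tri K) : t.hull ⊆ K.space := K.convexHull_subset_space t.2.1

lemma Tri.mem_vertices (t : Tri K) {a : Plane} (ha : a ∈ t.1) : a ∈ K.vertices :=
  K.down_closed t.2.1 (Finset.singleton_subset_iff.2 ha) (Finset.singleton_nonempty a)

lemma Tri.interior_hull_nonempty (t : Tri K) : (interior t.hull).Nonempty := by
  rw [Tri.hull, interior_convexHull_nonempty_iff_affineSpan_eq_top, ← t.range_basis]
  exact t.basis.tot

/-- Some vertex `a` of one triangle is not a vertex of the other. Its barycentric coordinate
vanishes at the common vertices, hence on the intersection, but is positive in the interior. -/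
lemma Tri.pairwise_disjoint_interior_hull :
    Pairwise (Function.onFun Disjoint fun t : Tri K => interior t.hull) := by
  classical
  intro t t' hne
  refine Set.disjoint_left.2 fun x hx hx' => ?_
  have hnsub : ¬ t.1 ⊆ t'.1 := fun h =>
    hne (Subtype.ext (Finset.eq_of_subset_of_card_le h (by rw [t.2.2, t'.2.2])))
  obtain ⟨a, hat, hat'⟩ := Finset.not_subset.1 hnsub
  have hmem := K.inter_subset_convexHull t.2.1 t'.2.1 ⟨interior_subset hx, interior_subset hx'⟩
  have hzero : EqOn (t.basis.coord ⟨a, hat⟩) (0 : Plane →ᵃ[ℝ] ℝ)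
      ((t.1 : Set Plane) ∩ (t'.1 : Set Plane)) := by
    rintro y ⟨hy, hy'⟩
    have hya : (⟨a, hat⟩ : t.1) ≠ ⟨y, hy⟩ := by
      intro h
      have : a = y := congrArg Subtype.val h
      exact hat' (this ▸ hy')
    have h0 : t.basis.coord ⟨a, hat⟩ (t.basis ⟨y, hy⟩) = 0 := t.basis.coord_apply_ne hya
    rw [Tri.basis_apply] at h0
    rw [h0, AffineMap.coe_zero, Pi.zero_apply]
  have := AffineMap.eqOn_affineSpan hzero (convexHull_subset_affineSpan _ hmem)
  rw [AffineMap.coe_zero, Pi.zero_apply] at this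
  have hpos : x ∈ interior t.hull := hx
  rw [Tri.interior_hull_eq] at hpos
  exact (hpos ⟨a, hat⟩).ne' this

/-- Affine interpolation of vertex values on a triangle. -/
def Tri.interp (t : Tri K) (c : Plane → 𝕜) : Plane →ᵃ[ℝ] 𝕜 where
  toFun x := ∑ a : t.1, t.basis.coord a x • c a
  linear := ∑ a : t.1, (t.basis.coord a).linear.smulRight (c a)
  map_vadd' p v := by
    have h : ∀ a : t.1, t.basis.coord a (v +ᵥ p) • c a =
        (t.basis.coord a).linear v • c a + t.basis.coord a p • c a := fun a => by
      rw [AffineMap.map_vadd, vadd_eq_add, add_smul]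
    rw [Finset.sum_congr rfl fun a _ => h a, Finset.sum_add_distrib, vadd_eq_add,
      LinearMap.sum_apply]
    rfl

lemma Tri.interp_apply (t : Tri K) (c : Plane → 𝕜) (x : Plane) :
    t.interp c x = ∑ a : t.1, t.basis.coord a x • c a := rfl

lemma Tri.interp_vertex (t : Tri K) (c : Plane → 𝕜) {a : Plane} (ha : a ∈ t.1) :
    t.interp c a = c a := by
  classical
  have h : ∀ b : t.1, t.basis.coord b a = if b = ⟨a, ha⟩ then 1 else 0 := fun b =>
    t.basis.coord_apply b ⟨a, ha⟩
  simp [Tri.interp_apply, h]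

lemma Tri.eq_interp (t : Tri K) {f : Plane →ᵃ[ℝ] 𝕜} {c : Plane → 𝕜} (h : ∀ a ∈ t.1, f a = c a) :
    f = t.interp c := by
  refine AffineMap.ext_on (s := (t.1 : Set Plane)) ?_ fun a ha => ?_
  · rw [← t.range_basis]; exact t.basis.tot
  · rw [h a ha, t.interp_vertex c ha]

lemma Tri.eqOn_interp (t : Tri K) {v : Plane → 𝕜} (hv : v ∈ P1 𝕜 K) :
    EqOn v (t.interp v) t.hull := by
  obtain ⟨f, hf⟩ := hv.2.2 t.1 t.2.1 t.2.2
  have : f = t.interp v := t.eq_interp fun a ha => (hf (subset_convexHull ℝ _ ha)).symm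
  exact this ▸ hf

lemma Tri.norm_interp_le (t : Tri K) {c : Plane → 𝕜} {m : ℝ} (hc : ∀ a ∈ t.1, ‖c a‖ ≤ m)
    {x : Plane} (hx : x ∈ t.hull) : ‖t.interp c x‖ ≤ m := by
  rw [Tri.hull_eq] at hx
  rw [Tri.interp_apply]
  calc ‖∑ a : t.1, t.basis.coord a x • c a‖ ≤ ∑ a : t.1, t.basis.coord a x * m := by
        refine norm_sum_le_of_le _ fun a _ => ?_
        rw [norm_smul, Real.norm_eq_abs, abs_of_nonneg (hx a)]
        exact mul_le_mul_of_nonneg_left (hc a a.2) (hx a)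
    _ = m := by rw [← Finset.sum_mul, t.basis.sum_coord_apply_eq_one, one_mul]

lemma IsTriangulation.space_eq_iUnion_hull (hK : IsTriangulation K Ω) :
    K.space = ⋃ t : Tri K, t.hull := by
  refine Subset.antisymm (fun x hx => ?_) (iUnion_subset fun t => t.hull_subset_space)
  obtain ⟨s, hs, hxs⟩ := Geometry.SimplicialComplex.mem_space_iff.1 hx
  obtain ⟨t, ht, hst, h3⟩ := hK.pure s hs
  exact mem_iUnion.2 ⟨⟨t, ht, h3⟩, convexHull_mono (by exact_mod_cast hst) hxs⟩

lemma IsTriangulation.finite_tri (hK : IsTriangulation K Ω) : Finite (Tri K) :=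
  (hK.finite.subset fun _ ht => ht.1).to_subtype

lemma IsTriangulation.finite_vertices (hK : IsTriangulation K Ω) : Finite K.vertices := by
  rw [K.vertices_eq]
  exact (hK.finite.biUnion fun s _ => s.finite_toSet).to_subtype

lemma IsTriangulation.norm_le_of_vertices (hK : IsTriangulation K Ω) {v : Plane → 𝕜}
    (hv : v ∈ P1 𝕜 K) {m : ℝ} (hm : 0 ≤ m) (h : ∀ a ∈ K.vertices, ‖v a‖ ≤ m) (x : Plane) :
    ‖v x‖ ≤ m := by
  by_cases hx : x ∈ K.space
  · rw [hK.space_eq_iUnion_hull] at hx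
    obtain ⟨t, ht⟩ := mem_iUnion.1 hx
    rw [t.eqOn_interp hv ht]
    exact t.norm_interp_le (fun a ha => h a (t.mem_vertices ha)) ht
  · rwa [hv.2.1 x hx, norm_zero]

lemma IsTriangulation.eq_zero_of_vertices (hK : IsTriangulation K Ω) {v : Plane → 𝕜}
    (hv : v ∈ P1 𝕜 K) (h : ∀ a ∈ K.vertices, v a = 0) : v = 0 := by
  ext x
  simpa using hK.norm_le_of_vertices hv le_rfl (fun a ha => by simp [h a ha]) x

/-- Vertex values can be prescribed arbitrarily. -/
lemma IsTriangulation.exists_P1 (hK : IsTriangulation K Ω) (c : Plane → 𝕜) :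
    ∃ v ∈ P1 𝕜 K, ∀ a ∈ K.vertices, v a = c a := by
  classical
  -- Conformity: two triangles meet inside the hull of their common vertices, where the interpolants
  -- agree, so the choice of triangle in `v` below is immaterial.
  have hagree : ∀ (t t' : Tri K) (x : Plane), x ∈ t.hull → x ∈ t'.hull →
      t.interp c x = t'.interp c x := by
    intro t t' x hx hx'
    have hmem := K.inter_subset_convexHull t.2.1 t'.2.1 ⟨hx, hx'⟩
    have heq : EqOn (t.interp c) (t'.interp c) ((t.1 : Set Plane) ∩ (t'.1 : Set Plane)) := by
      rintro y ⟨hy, hy'⟩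
      rw [t.interp_vertex c hy, t'.interp_vertex c hy']
    exact AffineMap.eqOn_affineSpan heq (convexHull_subset_affineSpan _ hmem)
  let v : Plane → 𝕜 := fun x => if h : ∃ t : Tri K, x ∈ t.hull then h.choose.interp c x else 0
  have hv : ∀ t : Tri K, EqOn v (t.interp c) t.hull := by
    intro t x hx
    have h : ∃ t : Tri K, x ∈ t.hull := ⟨t, hx⟩
    simp only [v, dif_pos h]
    exact hagree _ _ _ h.choose_spec hx
  have := hK.finite_tri
  refine ⟨v, ⟨?_, fun x hx => ?_, fun t ht h3 => ⟨Tri.interp ⟨t, ht, h3⟩ c, hv ⟨t, ht, h3⟩⟩⟩,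
    fun a ha => ?_⟩
  · rw [hK.space_eq_iUnion_hull]
    refine (locallyFinite_of_finite _).continuousOn_iUnion (fun t => t.isClosed_hull) fun t => ?_
    exact ((t.interp c).continuous_of_finiteDimensional.continuousOn).congr (hv t)
  · have h : ¬ ∃ t : Tri K, x ∈ t.hull := fun ⟨t, ht⟩ => hx (t.hull_subset_space ht)
    simp only [v, dif_neg h]
  · obtain ⟨t, ht, hst, h3⟩ := hK.pure {a} ha
    have hat : a ∈ t := hst (Finset.mem_singleton_self a)
    rw [hv ⟨t, ht, h3⟩ (subset_convexHull ℝ _ hat), Tri.interp_vertex _ c hat]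

/-- Piecewise affine functions are determined by arbitrary vertex values. -/
def IsTriangulation.nodal (hK : IsTriangulation K Ω) (𝕜 : Type) [RCLike 𝕜] :
    (K.vertices → 𝕜) ≃ₗ[𝕜] P1 𝕜 K :=
  (LinearEquiv.ofBijective
    (({ toFun := fun v a => v.1 a
        map_add' := fun _ _ => rfl
        map_smul' := fun _ _ => rfl }) : P1 𝕜 K →ₗ[𝕜] (K.vertices → 𝕜))
    ⟨(injective_iff_map_eq_zero _).2 fun v hv => Subtype.ext
        (hK.eq_zero_of_vertices v.2 fun a ha => congrFun hv ⟨a, ha⟩), fun c => by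
      classical
      obtain ⟨v, hv, hva⟩ := hK.exists_P1 fun a => if h : a ∈ K.vertices then c ⟨a, h⟩ else 0
      exact ⟨⟨v, hv⟩, funext fun a => by simpa using hva a a.2⟩⟩).symm

lemma IsTriangulation.nodal_vertex (hK : IsTriangulation K Ω) (c : K.vertices → 𝕜)
    (a : K.vertices) : (hK.nodal 𝕜 c : Plane → 𝕜) a = c a :=
  congrFun ((hK.nodal 𝕜).symm_apply_apply c) a

/-- A piecewise affine function vanishing at the Dirichlet vertices vanishes on the Dirichlet
part. -/
lemma IsTriangulation.eq_zero_on_dirichlet (hK : IsTriangulation K Ω)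
    (hΓD : IsDirichletPart K Ω ΓD) {v : Plane → 𝕜} (hv : v ∈ P1 𝕜 K)
    (h : ∀ a ∈ K.vertices, a ∈ ΓD → v a = 0) {x : Plane} (hx : x ∈ ΓD) : v x = 0 := by
  obtain ⟨S, -, hS, rfl⟩ := hΓD
  obtain ⟨s, hs, hxs⟩ := mem_iUnion₂.1 hx
  obtain ⟨t, ht, hst, h3⟩ := hK.pure s (hS s hs).1
  obtain ⟨f, hf⟩ := hv.2.2 t ht h3
  have hsub : convexHull ℝ (s : Set Plane) ⊆ convexHull ℝ (t : Set Plane) :=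
    convexHull_mono (by exact_mod_cast hst)
  have hf0 : EqOn f (0 : Plane →ᵃ[ℝ] 𝕜) (s : Set Plane) := by
    intro a ha
    rw [← hf (hsub (subset_convexHull ℝ _ ha))]
    exact h a (Tri.mem_vertices ⟨t, ht, h3⟩ (hst ha))
      (mem_iUnion₂.2 ⟨s, hs, subset_convexHull ℝ _ ha⟩)
  rw [hf (hsub hxs)]
  exact AffineMap.eqOn_affineSpan hf0 (convexHull_subset_affineSpan _ hxs)

/-- The open part of a triangle in the domain. -/
def Tri.cell (Ω : Set Plane) (t : Tri K) : Set Plane := interior t.hull ∩ Ω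

lemma Tri.cell_subset (t : Tri K) : t.cell Ω ⊆ Ω := inter_subset_right

lemma Tri.isOpen_cell (hΩ : IsOpen Ω) (t : Tri K) : IsOpen (t.cell Ω) := isOpen_interior.inter hΩ

lemma Tri.cell_nonempty (hK : IsTriangulation K Ω) (t : Tri K) : (t.cell Ω).Nonempty := by
  obtain ⟨x, hx⟩ := t.interior_hull_nonempty
  have : x ∈ closure Ω := hK.space_eq ▸ t.hull_subset_space (interior_subset hx)
  exact mem_closure_iff.1 this _ isOpen_interior hx

lemma Tri.pairwise_disjoint_cell :
    Pairwise (Function.onFun Disjoint fun t : Tri K => t.cell Ω) := fun _ _ hne =>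
  (Tri.pairwise_disjoint_interior_hull hne).mono inter_subset_left inter_subset_left

/-- The closed triangles cover `Ω`, and their frontiers are null by convexity. Intersecting with `Ω`
in the cells avoids having to show that open triangles lie in `Ω`. -/
lemma IsTriangulation.iUnion_cell_ae_eq (hK : IsTriangulation K Ω) :
    (⋃ t : Tri K, t.cell Ω) =ᵐ[volume] Ω := by
  have := hK.finite_tri
  refine Filter.Eventually.set_eq ?_
  have hnull : ∀ᵐ x ∂(volume : Measure Plane), ∀ t : Tri K, x ∉ frontier t.hull :=
    ae_all_iff.2 fun t => measure_eq_zero_iff_ae_notMem.1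
      ((convex_convexHull ℝ _).addHaar_frontier volume)
  filter_upwards [hnull] with x hx
  refine ⟨fun h => ?_, fun h => ?_⟩
  · obtain ⟨t, ht⟩ := mem_iUnion.1 h
    exact ht.2
  · have : x ∈ K.space := hK.space_eq ▸ subset_closure h
    rw [hK.space_eq_iUnion_hull] at this
    obtain ⟨t, ht⟩ := mem_iUnion.1 this
    refine mem_iUnion.2 ⟨t, ?_, h⟩
    by_contra hni
    exact hx t ⟨subset_closure ht, hni⟩

lemma IsTriangulation.setIntegral_eq_sum {F : Type*} [NormedAddCommGroup F] [NormedSpace ℝ F]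
    [Fintype (Tri K)] (hK : IsTriangulation K Ω) (hΩ : IsOpen Ω) {f : Plane → F}
    (hf : ∀ t : Tri K, IntegrableOn f (t.cell Ω)) :
    ∫ x in Ω, f x = ∑ t : Tri K, ∫ x in t.cell Ω, f x := by
  rw [← setIntegral_congr_set hK.iUnion_cell_ae_eq]
  exact integral_iUnion_fintype (fun t => (t.isOpen_cell hΩ).measurableSet)
    Tri.pairwise_disjoint_cell hf

/-- The gradient on a triangle of the piecewise affine function with given vertex values. -/
def Tri.grad (t : Tri K) (i : Fin 2) : (K.vertices → ℂ) →ₗ[ℂ] ℂ :=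
  ∑ a : t.1, ((t.basis.coord a).linear (EuclideanSpace.single i 1) : ℂ) •
    LinearMap.proj ⟨a.1, t.mem_vertices a.2⟩

lemma Tri.grad_eq_linear (t : Tri K) (hK : IsTriangulation K Ω) (c : K.vertices → ℂ)
    (i : Fin 2) :
    t.grad i c = (t.interp (hK.nodal ℂ c).1).linear (EuclideanSpace.single i 1) := by
  simp only [Tri.interp, Tri.grad, LinearMap.sum_apply, LinearMap.smul_apply,
    LinearMap.smulRight_apply, LinearMap.proj_apply, smul_eq_mul, Complex.real_smul]
  refine Finset.sum_congr rfl fun a _ => ?_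
  rw [hK.nodal_vertex c ⟨a.1, t.mem_vertices a.2⟩]

lemma Tri.cgrad_eq (t : Tri K) (hK : IsTriangulation K Ω) (c : K.vertices → ℂ) {x : Plane}
    (hx : x ∈ interior t.hull) (i : Fin 2) : cgrad (hK.nodal ℂ c) x i = t.grad i c := by
  rw [t.grad_eq_linear hK]
  have hv := (hK.nodal ℂ c).2
  set v : Plane → ℂ := (hK.nodal ℂ c).1
  have hev : v =ᶠ[𝓝 x] t.interp v := by
    filter_upwards [mem_interior_iff_mem_nhds.1 hx] with y hy using t.eqOn_interp hv hy
  have hd : HasFDerivAt (t.interp v) (LinearMap.toContinuousLinearMap (t.interp v).linear) x := by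
    have h1 := (LinearMap.toContinuousLinearMap (t.interp v).linear).hasFDerivAt (x := x)
    have h2 := h1.add_const (t.interp v 0)
    refine h2.congr_of_eventuallyEq (Eventually.of_forall fun y => ?_)
    have := (t.interp v).map_vadd 0 y
    simpa using this
  unfold cgrad
  rw [hev.fderiv_eq, hd.fderiv]
  rfl

/-- A piecewise affine function with vanishing gradient is constant on a connected domain. -/
lemma IsTriangulation.eq_of_grad_eq_zero (hK : IsTriangulation K Ω) (hΩ : IsConnected Ω)
    {c : K.vertices → ℂ} (hc : ∀ (t : Tri K) i, t.grad i c = 0) {x y : Plane}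
    (hx : x ∈ K.space) (hy : y ∈ K.space) :
    (hK.nodal ℂ c : Plane → ℂ) x = (hK.nodal ℂ c : Plane → ℂ) y := by
  have hv := (hK.nodal ℂ c).2
  set v : Plane → ℂ := (hK.nodal ℂ c).1 with hvdef
  have hlin : ∀ t : Tri K, (t.interp v).linear = 0 := by
    intro t
    refine (EuclideanSpace.basisFun (Fin 2) ℝ).toBasis.ext fun i => ?_
    rw [OrthonormalBasis.coe_toBasis, EuclideanSpace.basisFun_apply, ← t.grad_eq_linear hK, hc,
      LinearMap.zero_apply]
  -- The function is constant on each triangle, so it takes finitely many values; being continuous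
  -- on the connected closure of `Ω`, it is constant.
  have hsub : ∀ t : Tri K, (image v t.hull).Subsingleton := by
    rintro t _ ⟨p, hp, rfl⟩ _ ⟨q, hq, rfl⟩
    rw [t.eqOn_interp hv hp, t.eqOn_interp hv hq]
    have := (t.interp v).linearMap_vsub p q
    rw [hlin, LinearMap.zero_apply] at this
    exact (vsub_eq_zero_iff_eq.1 this.symm)
  have hfin : (image v K.space).Finite := by
    have := hK.finite_tri
    rw [hK.space_eq_iUnion_hull, image_iUnion]
    exact finite_iUnion fun t => (hsub t).finite
  refine IsPreconnected.constant_of_mapsTo (S := K.space) (T := image v K.space) ?_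
    hfin.isDiscrete hv.1 (mapsTo_image v _) hx hy
  rw [hK.space_eq]
  exact hΩ.isPreconnected.closure

end Triangulation

/-! ### The discrete form: uniform coercivity, boundedness, Lipschitz dependence -/

section DiscreteForm

variable {K : Mesh} {Ω ΓD : Set Plane}

/-- The area of the part of a triangle in the domain. -/
def Tri.area (Ω : Set Plane) (t : Tri K) : ℝ := volume.real (t.cell Ω)

lemma Tri.volume_cell_lt_top (hΩ : Bornology.IsBounded Ω) (t : Tri K) : volume (t.cell Ω) < ⊤ :=
  (hΩ.subset t.cell_subset).measure_lt_top

lemma Tri.area_nonneg (t : Tri K) : 0 ≤ t.area Ω := measureReal_nonneg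

lemma Tri.area_pos (hK : IsTriangulation K Ω) (hΩ : IsLipschitzDomain Ω) (t : Tri K) :
    0 < t.area Ω :=
  ENNReal.toReal_pos ((t.isOpen_cell hΩ.isOpen).measure_pos volume (t.cell_nonempty hK)).ne'
    (t.volume_cell_lt_top hΩ.isBounded).ne

/-- A bound for the gradient of a piecewise affine function by its vertex values. -/
def Tri.gradBound [Fintype K.vertices] (t : Tri K) (i : Fin 2) : ℝ :=
  ‖LinearMap.toContinuousLinearMap (t.grad i)‖

lemma Tri.gradBound_nonneg [Fintype K.vertices] (t : Tri K) (i : Fin 2) : 0 ≤ t.gradBound i :=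
  norm_nonneg _

lemma Tri.norm_grad_le [Fintype K.vertices] (t : Tri K) (i : Fin 2) (c : K.vertices → ℂ) :
    ‖t.grad i c‖ ≤ t.gradBound i * ‖c‖ :=
  (LinearMap.toContinuousLinearMap (t.grad i)).le_opNorm c

lemma IsTriangulation.norm_nodal_le [Fintype K.vertices]
    (hK : IsTriangulation K Ω) (c : K.vertices → ℂ) (x : Plane) :
    ‖(hK.nodal ℂ c : Plane → ℂ) x‖ ≤ ‖c‖ :=
  hK.norm_le_of_vertices (hK.nodal ℂ c).2 (norm_nonneg c) (fun a ha => by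
    rw [hK.nodal_vertex c ⟨a, ha⟩]; exact norm_le_pi_norm c ⟨a, ha⟩) x

lemma IsTriangulation.continuousOn_nodal (hK : IsTriangulation K Ω) (c : K.vertices → ℂ) :
    ContinuousOn (hK.nodal ℂ c : Plane → ℂ) (closure Ω) :=
  hK.space_eq ▸ (hK.nodal ℂ c).2.1

/-- The mean of a coefficient over a triangle, weighted by the area. -/
def IsTriangulation.coeff (hK : IsTriangulation K Ω) (B : ℝ → Matrix (Fin 2) (Fin 2) ℝ)
    (t : Tri K) (i : Fin 2) (c : K.vertices → ℂ) : ℝ :=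
  ∫ x in t.cell Ω, B ((hK.nodal ℂ c : Plane → ℂ) x).re i i

/-- Diagonal coefficient matrices with bounded Lipschitz entries. -/
structure IsLipschitzDiagonal (B : ℝ → Matrix (Fin 2) (Fin 2) ℝ) (M : ℝ) (C : ℝ≥0) : Prop where
  offDiag : ∀ s i j, i ≠ j → B s i j = 0
  bound : ∀ s i, |B s i i| ≤ M
  lip : ∀ i, LipschitzWith C fun s => B s i i

variable {B : ℝ → Matrix (Fin 2) (Fin 2) ℝ} {M : ℝ} {C : ℝ≥0}

lemma IsTriangulation.integrableOn_coeff (hK : IsTriangulation K Ω) (hΩ : IsLipschitzDomain Ω)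
    (hB : IsLipschitzDiagonal B M C) (t : Tri K) (i : Fin 2) (c : K.vertices → ℂ) :
    IntegrableOn (fun x => B ((hK.nodal ℂ c : Plane → ℂ) x).re i i) (t.cell Ω) := by
  have hcont : ContinuousOn (fun x => B ((hK.nodal ℂ c : Plane → ℂ) x).re i i) (t.cell Ω) :=
    (hB.lip i).continuous.comp_continuousOn (Complex.continuous_re.comp_continuousOn
      ((hK.continuousOn_nodal c).mono (t.cell_subset.trans subset_closure)))
  exact IntegrableOn.of_bound (t.volume_cell_lt_top hΩ.isBounded)
    (hcont.aestronglyMeasurable (t.isOpen_cell hΩ.isOpen).measurableSet) M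
    (Eventually.of_forall fun x => hB.bound _ i)

lemma IsTriangulation.abs_coeff_le (hK : IsTriangulation K Ω) (hΩ : IsLipschitzDomain Ω)
    (hB : IsLipschitzDiagonal B M C) (t : Tri K) (i : Fin 2) (c : K.vertices → ℂ) :
    |hK.coeff B t i c| ≤ M * t.area Ω :=
  norm_setIntegral_le_of_norm_le_const
    (f := fun x => B ((hK.nodal ℂ c : Plane → ℂ) x).re i i)
    (t.volume_cell_lt_top hΩ.isBounded) fun _ _ => hB.bound _ i

lemma IsTriangulation.abs_coeff_sub_le [Fintype K.vertices]
    (hK : IsTriangulation K Ω) (hΩ : IsLipschitzDomain Ω)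
    (hB : IsLipschitzDiagonal B M C) (t : Tri K) (i : Fin 2) (c c' : K.vertices → ℂ) :
    |hK.coeff B t i c - hK.coeff B t i c'| ≤ C * ‖c - c'‖ * t.area Ω := by
  unfold IsTriangulation.coeff
  rw [← integral_sub (hK.integrableOn_coeff hΩ hB t i c) (hK.integrableOn_coeff hΩ hB t i c')]
  refine norm_setIntegral_le_of_norm_le_const
    (f := fun x => B ((hK.nodal ℂ c : Plane → ℂ) x).re i i -
      B ((hK.nodal ℂ c' : Plane → ℂ) x).re i i)
    (t.volume_cell_lt_top hΩ.isBounded) fun x _ => ?_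
  refine ((hB.lip i).dist_le_mul _ _).trans ?_
  gcongr
  rw [Real.dist_eq, ← Complex.sub_re]
  refine (Complex.abs_re_le_norm _).trans ?_
  have := hK.norm_nodal_le (c - c') x
  rwa [map_sub] at this

/-- The sesquilinear form in terms of vertex values. -/
def IsTriangulation.form [Fintype (Tri K)]
    (hK : IsTriangulation K Ω) (B : ℝ → Matrix (Fin 2) (Fin 2) ℝ) (ε : ℝ)
    (c : K.vertices → ℂ) : (K.vertices → ℂ) →ₗ[ℂ] (K.vertices → ℂ) →ₗ⋆[ℂ] ℂ :=
  LinearMap.mk₂'ₛₗ (RingHom.id ℂ) (starRingEnd ℂ)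
    (fun u w => ∑ t : Tri K, ∑ i, ((hK.coeff B t i c : ℂ) + Complex.I * (ε * t.area Ω : ℝ)) *
      (t.grad i u * conj (t.grad i w)))
    (fun u u' w => by simp only [map_add, add_mul, mul_add, Finset.sum_add_distrib])
    (fun k u w => by
      simp only [map_smul, smul_eq_mul, RingHom.id_apply, Finset.mul_sum]
      refine Finset.sum_congr rfl fun t _ => Finset.sum_congr rfl fun i _ => by ring)
    (fun u w w' => by simp only [map_add, mul_add, Finset.sum_add_distrib])
    (fun k u w => by
      simp only [map_smul, smul_eq_mul, map_mul, Finset.mul_sum]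
      refine Finset.sum_congr rfl fun t _ => Finset.sum_congr rfl fun i _ => by ring)

lemma IsTriangulation.form_apply [Fintype (Tri K)]
    (hK : IsTriangulation K Ω) (ε : ℝ) (c u w : K.vertices → ℂ) :
    hK.form B ε c u w = ∑ t : Tri K, ∑ i, ((hK.coeff B t i c : ℂ) +
      Complex.I * (ε * t.area Ω : ℝ)) * (t.grad i u * conj (t.grad i w)) := rfl

/-- Both gradients are constant on a cell, so only the diagonal coefficients remain to be
integrated. -/
lemma IsTriangulation.aEps_eq [Fintype (Tri K)]
    (hK : IsTriangulation K Ω) (hΩ : IsLipschitzDomain Ω)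
    (hB : IsLipschitzDiagonal B M C) (ε : ℝ) (c u w : K.vertices → ℂ) :
    aEps Ω B ε (fun x => ((hK.nodal ℂ c : Plane → ℂ) x).re) (hK.nodal ℂ u) (hK.nodal ℂ w) =
      hK.form B ε c u w := by
  let F : Tri K → Plane → ℂ := fun t x => ∑ i, ((B ((hK.nodal ℂ c : Plane → ℂ) x).re i i : ℂ) +
    Complex.I * ε) * (t.grad i u * conj (t.grad i w))
  have hcoef : ∀ (t : Tri K) i, IntegrableOn (fun x =>
      ((B ((hK.nodal ℂ c : Plane → ℂ) x).re i i : ℂ) + Complex.I * ε)) (t.cell Ω) := fun t i =>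
    (hK.integrableOn_coeff hΩ hB t i c).ofReal.add
      (integrableOn_const (t.volume_cell_lt_top hΩ.isBounded).ne)
  have hFint : ∀ t : Tri K, IntegrableOn (F t) (t.cell Ω) := fun t =>
    integrable_finsetSum _ fun i _ => (hcoef t i).mul_const _
  have hEq : ∀ t : Tri K, EqOn (F t) (fun x => (((B ((hK.nodal ℂ c : Plane → ℂ) x).re).map
      Complex.ofReal + (Complex.I * (ε : ℂ)) • (1 : Matrix (Fin 2) (Fin 2) ℂ)) *ᵥ
        cgrad (hK.nodal ℂ u) x) ⬝ᵥ star (cgrad (hK.nodal ℂ w) x)) (t.cell Ω) := by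
    intro t x hx
    have h01 := hB.offDiag ((hK.nodal ℂ c : Plane → ℂ) x).re 0 1 (by decide)
    have h10 := hB.offDiag ((hK.nodal ℂ c : Plane → ℂ) x).re 1 0 (by decide)
    simp only [F, dotProduct, Matrix.mulVec, Fin.sum_univ_two, Matrix.add_apply, Matrix.map_apply,
      Matrix.smul_apply, Matrix.one_apply, Pi.star_apply, t.cgrad_eq hK _ hx.1, h01, h10]
    simp [mul_assoc]
  unfold aEps
  rw [hK.setIntegral_eq_sum hΩ.isOpen fun t =>
    (hFint t).congr_fun (hEq t) (t.isOpen_cell hΩ.isOpen).measurableSet, hK.form_apply]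
  refine Finset.sum_congr rfl fun t _ => ?_
  rw [← setIntegral_congr_fun (t.isOpen_cell hΩ.isOpen).measurableSet (hEq t)]
  simp only [F]
  rw [integral_finsetSum _ fun i _ => (hcoef t i).mul_const _]
  refine Finset.sum_congr rfl fun i _ => ?_
  have hconst : IntegrableOn (fun _ => Complex.I * (ε : ℂ)) (t.cell Ω) volume :=
    integrableOn_const (t.volume_cell_lt_top hΩ.isBounded).ne
  have hre : IntegrableOn (fun x => ((B ((hK.nodal ℂ c : Plane → ℂ) x).re i i : ℝ) : ℂ))
      (t.cell Ω) := (hK.integrableOn_coeff hΩ hB t i c).ofReal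
  have hsum : ∫ x in t.cell Ω, ((B ((hK.nodal ℂ c : Plane → ℂ) x).re i i : ℂ) + Complex.I * ε) =
      (hK.coeff B t i c : ℂ) + Complex.I * (ε * t.area Ω : ℝ) := by
    refine (integral_add hre hconst).trans ?_
    rw [setIntegral_const, IsTriangulation.coeff]
    refine congrArg₂ (· + ·) integral_ofReal ?_
    rw [Complex.real_smul, Tri.area]
    push_cast
    ring
  exact (integral_mul_const _ _).trans (congrArg (· * _) hsum)

/-- The vertex values of functions vanishing on the Dirichlet part. -/
def dirichletZero (K : Mesh) (ΓD : Set Plane) : Submodule ℂ (K.vertices → ℂ) where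
  carrier := {c | ∀ a : K.vertices, a.1 ∈ ΓD → c a = 0}
  zero_mem' := fun _ _ => rfl
  add_mem' := fun h h' a ha => by simp [h a ha, h' a ha]
  smul_mem' := fun k c h a ha => by simp [h a ha]

lemma IsDirichletPart.exists_vertex (hΓD : IsDirichletPart K Ω ΓD) :
    ∃ a : K.vertices, a.1 ∈ ΓD := by
  obtain ⟨S, ⟨s, hs⟩, hS, rfl⟩ := hΓD
  obtain ⟨a, ha⟩ := K.nonempty_of_mem_faces (hS s hs).1
  exact ⟨⟨a, K.down_closed (hS s hs).1 (Finset.singleton_subset_iff.2 ha)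
    (Finset.singleton_nonempty a)⟩, mem_iUnion₂.2 ⟨s, hs, subset_convexHull ℝ _ ha⟩⟩

/-- The discrete Poincaré inequality. -/
lemma IsTriangulation.exists_poincare [Fintype (Tri K)] [Fintype K.vertices]
    (hK : IsTriangulation K Ω) (hΩ : IsLipschitzDomain Ω)
    (hΓD : IsDirichletPart K Ω ΓD) : ∃ κ > 0, ∀ w ∈ dirichletZero K ΓD,
      κ * ‖w‖ ^ 2 ≤ ∑ t : Tri K, ∑ i, t.area Ω * ‖t.grad i w‖ ^ 2 := by
  -- The weights `√area` make each `‖D w p‖²` a term of the Dirichlet sum. A vanishing gradient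
  -- makes `w` constant, and a Dirichlet vertex makes it zero; an injective linear map in finite
  -- dimension is bounded below.
  let D : dirichletZero K ΓD →ₗ[ℂ] (Tri K × Fin 2 → ℂ) :=
    LinearMap.pi fun p => ((√(p.1.area Ω) : ℝ) : ℂ) •
      (p.1.grad p.2 ∘ₗ (dirichletZero K ΓD).subtype)
  have hD : ∀ w p, D w p = ((√(p.1.area Ω) : ℝ) : ℂ) * p.1.grad p.2 w := fun _ _ => rfl
  have hker : D.ker = ⊥ := by
    refine LinearMap.ker_eq_bot'.2 fun w hw => ?_
    have hgrad : ∀ (t : Tri K) i, t.grad i w.1 = 0 := fun t i => by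
      have h1 := congrFun hw (t, i)
      rw [hD] at h1
      refine (mul_eq_zero.1 h1).resolve_left ?_
      exact Complex.ofReal_ne_zero.2 (Real.sqrt_pos.2 (t.area_pos hK hΩ)).ne'
    obtain ⟨a, ha⟩ := hΓD.exists_vertex
    ext b
    have := hK.eq_of_grad_eq_zero hΩ.isConnected hgrad (K.vertices_subset_space b.2)
      (K.vertices_subset_space a.2)
    rw [hK.nodal_vertex, hK.nodal_vertex, w.2 a ha] at this
    exact this
  obtain ⟨k, hk, hanti⟩ := D.exists_antilipschitzWith hker
  refine ⟨((k : ℝ) ^ 2)⁻¹, by positivity, fun w hw => ?_⟩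
  set S := ∑ t : Tri K, ∑ i, t.area Ω * ‖t.grad i w‖ ^ 2 with hS
  have hterm : ∀ (t : Tri K) i, 0 ≤ t.area Ω * ‖t.grad i w‖ ^ 2 := fun t i =>
    mul_nonneg t.area_nonneg (sq_nonneg _)
  have hS0 : 0 ≤ S := Finset.sum_nonneg fun t _ => Finset.sum_nonneg fun i _ => hterm t i
  have hle : ‖D ⟨w, hw⟩‖ ≤ √S := by
    refine (pi_norm_le_iff_of_nonneg (Real.sqrt_nonneg _)).2 fun p => ?_
    refine Real.le_sqrt_of_sq_le ?_
    rw [hD, norm_mul, mul_pow, Complex.norm_real, Real.norm_eq_abs, sq_abs,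
      Real.sq_sqrt p.1.area_nonneg]
    exact (Finset.single_le_sum (f := fun i => p.1.area Ω * ‖p.1.grad i w‖ ^ 2)
      (fun i _ => hterm p.1 i) (Finset.mem_univ p.2)).trans
      (Finset.single_le_sum (f := fun t : Tri K => ∑ i, t.area Ω * ‖t.grad i w‖ ^ 2)
      (fun t _ => Finset.sum_nonneg fun i _ => hterm t i) (Finset.mem_univ p.1))
  have h1 : ‖w‖ ≤ k * √S := by
    have := hanti.le_mul_dist ⟨w, hw⟩ 0
    rw [map_zero, dist_zero_right, dist_zero_right] at this
    exact this.trans (mul_le_mul_of_nonneg_left hle k.2)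
  have hk' : (0 : ℝ) < k := hk
  rw [inv_mul_le_iff₀ (by positivity)]
  calc ‖w‖ ^ 2 ≤ (k * √S) ^ 2 := by gcongr
    _ = k ^ 2 * S := by rw [mul_pow, Real.sq_sqrt hS0]

/-- On the diagonal each term is its coefficient times `|∇w|²`; the entries of `B` are real, so only
the `ε` part is imaginary. -/
lemma IsTriangulation.im_form [Fintype (Tri K)]
    (hK : IsTriangulation K Ω) (ε : ℝ) (c w : K.vertices → ℂ) :
    (hK.form B ε c w w).im = ε * ∑ t : Tri K, ∑ i, t.area Ω * ‖t.grad i w‖ ^ 2 := by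
  rw [hK.form_apply, Complex.im_sum, Finset.mul_sum]
  refine Finset.sum_congr rfl fun t _ => ?_
  rw [Complex.im_sum, Finset.mul_sum]
  refine Finset.sum_congr rfl fun i _ => ?_
  rw [Complex.mul_conj, Complex.normSq_eq_norm_sq, Complex.im_mul_ofReal]
  simp [mul_assoc]

lemma IsTriangulation.exists_isCoerciveFamily [Fintype (Tri K)] [Fintype K.vertices]
    (hK : IsTriangulation K Ω)
    (hΩ : IsLipschitzDomain Ω) (hΓD : IsDirichletPart K Ω ΓD) (hB : IsLipschitzDiagonal B M C)
    {ε : ℝ} (hε : 0 < ε) :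
    ∃ κ M' L, IsCoerciveFamily (dirichletZero K ΓD) (hK.form B ε) κ M' L := by
  obtain ⟨κ, hκ, hpoinc⟩ := hK.exists_poincare hΩ hΓD
  have hM : 0 ≤ M := (abs_nonneg _).trans (hB.bound 0 0)
  refine ⟨ε * κ, ∑ t : Tri K, ∑ i, (M + ε) * t.area Ω * t.gradBound i ^ 2,
    ∑ t : Tri K, ∑ i, C * t.area Ω * t.gradBound i ^ 2, by positivity, ?_, ?_, fun c w hw => ?_,
    fun c u w => ?_, fun c c' u w => ?_⟩
  · exact Finset.sum_nonneg fun t _ => Finset.sum_nonneg fun i _ => by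
      have := t.area_nonneg (Ω := Ω); positivity
  · exact Finset.sum_nonneg fun t _ => Finset.sum_nonneg fun i _ => by
      have := t.area_nonneg (Ω := Ω); positivity
  · refine le_trans ?_ (Complex.abs_im_le_norm _)
    rw [hK.im_form, mul_assoc]
    exact (mul_le_mul_of_nonneg_left (hpoinc w hw) hε.le).trans (le_abs_self _)
  · rw [hK.form_apply, Finset.sum_mul, Finset.sum_mul]
    refine norm_sum_le_of_le _ fun t _ => ?_
    rw [Finset.sum_mul, Finset.sum_mul]
    refine norm_sum_le_of_le _ fun i _ => ?_
    have h1 : ‖(hK.coeff B t i c : ℂ) + Complex.I * (ε * t.area Ω : ℝ)‖ ≤ (M + ε) * t.area Ω := by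
      refine (norm_add_le _ _).trans ?_
      rw [norm_mul, Complex.norm_I, one_mul, Complex.norm_real, Complex.norm_real,
        Real.norm_of_nonneg (mul_nonneg hε.le t.area_nonneg), add_mul]
      exact add_le_add_left (hK.abs_coeff_le hΩ hB t i c) _
    rw [norm_mul, norm_mul, RCLike.norm_conj]
    calc _ ≤ (M + ε) * t.area Ω * ((t.gradBound i * ‖u‖) * (t.gradBound i * ‖w‖)) :=
          mul_le_mul h1 (mul_le_mul (t.norm_grad_le i u) (t.norm_grad_le i w) (norm_nonneg _)
            (mul_nonneg (t.gradBound_nonneg i) (norm_nonneg _))) (by positivity)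
            ((norm_nonneg _).trans h1)
      _ = _ := by ring
  · rw [hK.form_apply, hK.form_apply, ← Finset.sum_sub_distrib]
    simp_rw [← Finset.sum_sub_distrib, ← sub_mul, add_sub_add_right_eq_sub, Finset.sum_mul]
    refine norm_sum_le_of_le _ fun t _ => norm_sum_le_of_le _ fun i _ => ?_
    rw [norm_mul, norm_mul, RCLike.norm_conj, ← Complex.ofReal_sub, Complex.norm_real]
    calc _ ≤ C * ‖c - c'‖ * t.area Ω * ((t.gradBound i * ‖u‖) * (t.gradBound i * ‖w‖)) :=
          mul_le_mul (hK.abs_coeff_sub_le hΩ hB t i c c')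
            (mul_le_mul (t.norm_grad_le i u) (t.norm_grad_le i w) (norm_nonneg _)
            (mul_nonneg (t.gradBound_nonneg i) (norm_nonneg _))) (by positivity)
            (by have := t.area_nonneg (Ω := Ω); positivity)
      _ = _ := by ring

end DiscreteForm

/-! ### Equivalence of the `H¹` norm and the norm of the vertex values -/

section Norm

variable {K : Mesh} {Ω ΓD : Set Plane}

lemma IsTriangulation.aestronglyMeasurable_nodal (hK : IsTriangulation K Ω)
    (hΩ : IsLipschitzDomain Ω) (c : K.vertices → ℂ) :
    AEStronglyMeasurable (hK.nodal ℂ c : Plane → ℂ) (volume.restrict Ω) :=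
  ((hK.continuousOn_nodal c).mono subset_closure).aestronglyMeasurable hΩ.isOpen.measurableSet

lemma IsTriangulation.memLp_nodal [Fintype K.vertices] (hK : IsTriangulation K Ω)
    (hΩ : IsLipschitzDomain Ω) (c : K.vertices → ℂ) :
    MemLp (hK.nodal ℂ c : Plane → ℂ) 2 (volume.restrict Ω) := by
  have : IsFiniteMeasure (volume.restrict Ω) :=
    isFiniteMeasure_restrict.2 hΩ.isBounded.measure_lt_top.ne
  exact MemLp.of_bound (hK.aestronglyMeasurable_nodal hΩ c) ‖c‖
    (Eventually.of_forall (hK.norm_nodal_le c))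

lemma IsTriangulation.eqOn_vNorm_integrand (hK : IsTriangulation K Ω) (c : K.vertices → ℂ)
    (t : Tri K) : EqOn (fun x => ‖(hK.nodal ℂ c : Plane → ℂ) x‖ ^ 2 + ∑ i, ‖t.grad i c‖ ^ 2)
      (fun x => ‖(hK.nodal ℂ c : Plane → ℂ) x‖ ^ 2 + ∑ i, ‖cgrad (hK.nodal ℂ c) x i‖ ^ 2)
      (t.cell Ω) := by
  intro x hx
  simp only [t.cgrad_eq hK c hx.1]

lemma IsTriangulation.integrableOn_vNorm_integrand [Fintype K.vertices] (hK : IsTriangulation K Ω)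
    (hΩ : IsLipschitzDomain Ω) (c : K.vertices → ℂ) (t : Tri K) :
    IntegrableOn (fun x => ‖(hK.nodal ℂ c : Plane → ℂ) x‖ ^ 2 +
      ∑ i, ‖cgrad (hK.nodal ℂ c) x i‖ ^ 2) (t.cell Ω) := by
  refine IntegrableOn.congr_fun ?_ (hK.eqOn_vNorm_integrand c t)
    (t.isOpen_cell hΩ.isOpen).measurableSet
  have h1 : IntegrableOn (fun x => ‖(hK.nodal ℂ c : Plane → ℂ) x‖ ^ 2) Ω :=
    (hK.memLp_nodal hΩ c).integrable_norm_pow two_ne_zero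
  exact (h1.mono_set t.cell_subset).add
    (integrableOn_const (t.volume_cell_lt_top hΩ.isBounded).ne)

/-- The `H¹` norm is bounded by the vertex values. -/
lemma IsTriangulation.exists_vNorm_le [Fintype (Tri K)] [Fintype K.vertices]
    (hK : IsTriangulation K Ω) (hΩ : IsLipschitzDomain Ω) :
    ∃ k ≥ 0, ∀ c : K.vertices → ℂ, vNorm Ω (hK.nodal ℂ c) ≤ k * ‖c‖ := by
  refine ⟨√(∑ t : Tri K, (1 + ∑ i, t.gradBound i ^ 2) * t.area Ω), Real.sqrt_nonneg _,
    fun c => Real.sqrt_le_iff.2 ⟨by positivity, ?_⟩⟩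
  have hnn : 0 ≤ ∑ t : Tri K, (1 + ∑ i, t.gradBound i ^ 2) * t.area Ω :=
    Finset.sum_nonneg fun t _ => by have := t.area_nonneg (Ω := Ω); positivity
  rw [hK.setIntegral_eq_sum hΩ.isOpen fun t => hK.integrableOn_vNorm_integrand hΩ c t, mul_pow,
    Real.sq_sqrt hnn, Finset.sum_mul]
  refine Finset.sum_le_sum fun t _ => (Real.le_norm_self _).trans ?_
  rw [← setIntegral_congr_fun (t.isOpen_cell hΩ.isOpen).measurableSet
    (hK.eqOn_vNorm_integrand c t)]
  have hb : ∀ x, ‖‖(hK.nodal ℂ c : Plane → ℂ) x‖ ^ 2 + ∑ i, ‖t.grad i c‖ ^ 2‖ ≤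
      (1 + ∑ i, t.gradBound i ^ 2) * ‖c‖ ^ 2 := by
    intro x
    rw [Real.norm_of_nonneg (by positivity), add_mul, one_mul, Finset.sum_mul]
    gcongr with i
    · exact hK.norm_nodal_le c x
    · rw [← mul_pow]
      gcongr
      exact t.norm_grad_le i c
  refine (norm_setIntegral_le_of_norm_le_const (t.volume_cell_lt_top hΩ.isBounded)
    fun x _ => hb x).trans_eq ?_
  rw [Tri.area]
  ring

/-- The vertex values are bounded by the `H¹` norm. -/
lemma IsTriangulation.exists_norm_le_vNorm [Fintype (Tri K)] [Fintype K.vertices]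
    (hK : IsTriangulation K Ω) (hΩ : IsLipschitzDomain Ω) :
    ∃ k ≥ 0, ∀ c : K.vertices → ℂ, ‖c‖ ≤ k * vNorm Ω (hK.nodal ℂ c) := by
  -- The `L²` part suffices: the embedding into `L²(Ω)` is injective by continuity up to the
  -- closure, hence bounded below.
  let T : (K.vertices → ℂ) →ₗ[ℂ] Lp ℂ 2 (volume.restrict Ω) :=
    { toFun := fun c => (hK.memLp_nodal hΩ c).toLp _
      map_add' := fun c c' => by
        rw [← MemLp.toLp_add]
        exact MemLp.toLp_congr _ _ (by rw [map_add]; rfl)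
      map_smul' := fun k c => by
        rw [RingHom.id_apply, ← MemLp.toLp_const_smul]
        exact MemLp.toLp_congr _ _ (by rw [map_smul]; rfl) }
  have hker : T.ker = ⊥ := by
    refine LinearMap.ker_eq_bot'.2 fun c hc => ?_
    have hae : (hK.nodal ℂ c : Plane → ℂ) =ᵐ[volume.restrict Ω] 0 := by
      have h1 := (hK.memLp_nodal hΩ c).coeFn_toLp
      have h2 : (hK.memLp_nodal hΩ c).toLp _ = 0 := hc
      rw [h2] at h1
      exact h1.symm.trans (Lp.coeFn_zero _ _ _)
    have hΩ0 : EqOn (hK.nodal ℂ c : Plane → ℂ) 0 Ω :=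
      Measure.eqOn_open_of_ae_eq hae hΩ.isOpen
        ((hK.continuousOn_nodal c).mono subset_closure) continuousOn_const
    have hcl : EqOn (hK.nodal ℂ c : Plane → ℂ) 0 (closure Ω) :=
      hΩ0.of_subset_closure (hK.continuousOn_nodal c) continuousOn_const subset_closure
        subset_rfl
    ext a
    rw [← hK.nodal_vertex c a]
    exact hcl (hK.space_eq ▸ K.vertices_subset_space a.2)
  obtain ⟨k, -, hanti⟩ := T.exists_antilipschitzWith hker
  refine ⟨k, k.2, fun c => ?_⟩
  have h1 := hanti.le_mul_dist c 0
  rw [map_zero, dist_zero_right, dist_zero_right] at h1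
  refine h1.trans (mul_le_mul_of_nonneg_left ?_ k.2)
  refine Real.le_sqrt_of_sq_le ?_
  have h2 : ‖T c‖ ^ 2 = ∫ x in Ω, ‖(hK.nodal ℂ c : Plane → ℂ) x‖ ^ 2 := by
    have h := Lp.norm_toLp _ (hK.memLp_nodal hΩ c)
    rw [(hK.memLp_nodal hΩ c).eLpNorm_eq_integral_rpow_norm two_ne_zero ENNReal.ofNat_ne_top,
      ENNReal.toReal_ofReal (by positivity)] at h
    have hnn : 0 ≤ ∫ x in Ω, ‖(hK.nodal ℂ c : Plane → ℂ) x‖ ^ (2 : ENNReal).toReal :=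
      integral_nonneg fun x => by positivity
    change ‖(hK.memLp_nodal hΩ c).toLp _‖ ^ 2 = _
    rw [h, ← Real.rpow_natCast, ← Real.rpow_mul hnn]
    simp
  rw [h2]
  have h3 : IntegrableOn (fun x => ‖(hK.nodal ℂ c : Plane → ℂ) x‖ ^ 2) Ω :=
    (hK.memLp_nodal hΩ c).integrable_norm_pow two_ne_zero
  rw [hK.setIntegral_eq_sum hΩ.isOpen fun t => hK.integrableOn_vNorm_integrand hΩ c t,
    hK.setIntegral_eq_sum hΩ.isOpen fun t => h3.mono_set t.cell_subset]
  refine Finset.sum_le_sum fun t _ => integral_mono (h3.mono_set t.cell_subset)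
    (hK.integrableOn_vNorm_integrand hΩ c t) fun x => ?_
  simp only [le_add_iff_nonneg_right]
  positivity

end Norm

/-! ### Length of the boundary, and bounds for the Neumann and Dirichlet data -/

section Boundary

variable {K : Mesh} {Ω ΓD : Set Plane}

/-- A Lipschitz domain lies locally on one side of its boundary. -/
lemma IsLipschitzDomain.disjoint_frontier_interior_closure (hΩ : IsLipschitzDomain Ω) :
    Disjoint (frontier Ω) (interior (closure Ω)) := by
  refine Set.disjoint_left.2 fun x hx hxi => ?_
  obtain ⟨U, hU, hxU, e, L, φ, hφ, hUΩ⟩ := hΩ.lipschitz x hx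
  have hxΩ : x ∉ Ω := fun h => by
    rw [hΩ.isOpen.frontier_eq] at hx
    exact hx.2 h
  have hxle : e x 1 ≤ φ (e x 0) := not_lt.1 fun h => hxΩ ((hUΩ x hxU).2 h)
  let d : Plane := e.symm (EuclideanSpace.single 1 1)
  have hcont : Continuous fun s : ℝ => x - s • d := by fun_prop
  have hmem : ∀ᶠ s : ℝ in 𝓝[>] 0, x - s • d ∈ U ∩ interior (closure Ω) := by
    refine (hcont.tendsto 0).eventually ?_ |>.filter_mono nhdsWithin_le_nhds
    simpa using (hU.inter isOpen_interior).mem_nhds ⟨hxU, hxi⟩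
  obtain ⟨s, ⟨hsU, hsi⟩, hs⟩ := (hmem.and self_mem_nhdsWithin).exists
  have hs0 : 0 < s := hs
  -- Moving down from `x` leads strictly below the graph while staying in the closure of `Ω`; but a
  -- neighbourhood of `y` below the graph contains no point of `Ω`.
  set y := x - s • d
  have hey : e y = e x - s • EuclideanSpace.single 1 1 := by
    simp [y, d]
  have hlt : e y 1 < φ (e y 0) := by
    rw [hey]
    simp
    linarith
  let N : Set Plane := {z | e z 1 < φ (e z 0)}
  have hN : IsOpen N := by
    have h0 : ∀ i : Fin 2, Continuous fun z : Plane => e z i := fun i =>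
      (EuclideanSpace.proj (𝕜 := ℝ) i).continuous.comp e.continuous
    exact isOpen_lt (h0 1) (hφ.continuous.comp (h0 0))
  obtain ⟨z, ⟨hzU, hzN⟩, hzΩ⟩ := mem_closure_iff.1 (interior_subset hsi) (U ∩ N) (hU.inter hN)
    ⟨hsU, hlt⟩
  exact lt_asymm hzN ((hUΩ z hzU).1 hzΩ)

/-- A point of a triangle that is not interior lies on an edge. -/
lemma Tri.mem_skeleton (t : Tri K) {x : Plane} (hx : x ∈ t.hull) (hxi : x ∉ interior t.hull) :
    x ∈ skeleton K := by
  classical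
  rw [t.interior_hull_eq] at hxi
  rw [t.hull_eq] at hx
  have hxi' : ∃ a, t.basis.coord a x ≤ 0 := by simpa using hxi
  obtain ⟨a, ha⟩ := hxi'
  have ha0 : t.basis.coord a x = 0 := le_antisymm ha (hx a)
  have hcard : (t.1.erase a).card = 2 := by rw [Finset.card_erase_of_mem a.2, t.2.2]
  refine mem_iUnion₂.2 ⟨t.1.erase a, ⟨K.down_closed t.2.1 (Finset.erase_subset _ _)
    (Finset.card_pos.1 (by omega)), hcard⟩, ?_⟩
  have hsum := t.basis.linear_combination_coord_eq_self x
  rw [← Finset.sum_erase Finset.univ (a := a) (by rw [ha0, zero_smul])] at hsum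
  rw [← hsum]
  refine (convex_convexHull ℝ _).sum_mem (fun i _ => hx i) ?_ fun i hi => ?_
  · rw [Finset.sum_erase (f := fun i => t.basis.coord i x) Finset.univ ha0]
    exact t.basis.sum_coord_apply_eq_one x
  · refine subset_convexHull ℝ _ ?_
    rw [Finset.mem_coe, Finset.mem_erase]
    exact ⟨fun h => Finset.ne_of_mem_erase hi (Subtype.ext h), i.2⟩

/-- A boundary point in the interior of a triangle would be interior to the closure of `Ω`; the
Lipschitz condition rules out such slits. -/
lemma IsTriangulation.frontier_subset_skeleton (hK : IsTriangulation K Ω)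
    (hΩ : IsLipschitzDomain Ω) : frontier Ω ⊆ skeleton K := by
  intro x hx
  have h1 : x ∈ K.space := hK.space_eq ▸ frontier_subset_closure hx
  have h2 := h1
  rw [hK.space_eq_iUnion_hull] at h2
  obtain ⟨t, ht⟩ := mem_iUnion.1 h2
  refine t.mem_skeleton ht fun hi => Set.disjoint_left.1 hΩ.disjoint_frontier_interior_closure hx ?_
  rw [← hK.space_eq]
  exact interior_mono t.hull_subset_space hi

lemma arcLength_convexHull_lt_top {s : Finset Plane} (hs : s.card = 2) :
    arcLength (convexHull ℝ (s : Set Plane)) < ⊤ := by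
  classical
  obtain ⟨a, b, -, rfl⟩ := Finset.card_eq_two.1 hs
  rw [Finset.coe_pair, convexHull_pair, hausdorffMeasure_segment]
  exact edist_lt_top a b

/-- Finite length is what makes an `L²` Neumann datum integrable against bounded functions. -/
lemma IsTriangulation.arcLength_frontier_lt_top (hK : IsTriangulation K Ω)
    (hΩ : IsLipschitzDomain Ω) : arcLength (frontier Ω) < ⊤ := by
  refine (measure_mono (hK.frontier_subset_skeleton hΩ)).trans_lt ?_
  exact measure_biUnion_lt_top (hK.finite.subset fun s hs => hs.1)
    fun s hs => arcLength_convexHull_lt_top hs.2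

lemma IsTriangulation.isClosed_dirichlet (hK : IsTriangulation K Ω)
    (hΓD : IsDirichletPart K Ω ΓD) : IsClosed ΓD := by
  obtain ⟨S, -, hS, rfl⟩ := hΓD
  exact (hK.finite.subset fun s hs => (hS s hs).1).isClosed_biUnion fun s _ =>
    (s.finite_toSet.isCompact_convexHull ℝ).isClosed

/-- The Neumann functional is a bounded conjugate-linear function of the vertex values. -/
lemma IsTriangulation.exists_ell [Fintype K.vertices] (hK : IsTriangulation K Ω)
    (hΩ : IsLipschitzDomain Ω) (hΓD : IsDirichletPart K Ω ΓD) {g : Plane → ℝ}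
    (hg : MemLp g 2 (arcLength.restrict (frontier Ω \ ΓD))) :
    ∃ l : (K.vertices → ℂ) →ₗ⋆[ℂ] ℂ, (∀ c, l c = ell Ω ΓD g (hK.nodal ℂ c)) ∧
      ∀ c, ‖l c‖ ≤ √(arcLength (frontier Ω \ ΓD)).toReal *
        (eLpNorm g 2 (arcLength.restrict (frontier Ω \ ΓD))).toReal * ‖c‖ := by
  set N := frontier Ω \ ΓD
  have hNm : MeasurableSet N :=
    isClosed_frontier.measurableSet.diff (hK.isClosed_dirichlet hΓD).measurableSet
  have hNfin : arcLength N < ⊤ :=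
    (measure_mono sdiff_subset).trans_lt (hK.arcLength_frontier_lt_top hΩ)
  have : IsFiniteMeasure (arcLength.restrict N) := isFiniteMeasure_restrict.2 hNfin.ne
  have hg1 : Integrable g (arcLength.restrict N) := hg.integrable one_le_two
  have hmeas : ∀ c : K.vertices → ℂ, AEStronglyMeasurable
      (fun x => conj ((hK.nodal ℂ c : Plane → ℂ) x)) (arcLength.restrict N) := fun c =>
    (Complex.continuous_conj.comp_continuousOn ((hK.continuousOn_nodal c).mono
      (sdiff_subset.trans frontier_subset_closure))).aestronglyMeasurable hNm
  have hint : ∀ c : K.vertices → ℂ, Integrable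
      (fun x => (g x : ℂ) * conj ((hK.nodal ℂ c : Plane → ℂ) x)) (arcLength.restrict N) := fun c =>
    hg1.ofReal.mul_bdd (c := ‖c‖) (hmeas c) (Eventually.of_forall fun x => by
      rw [RCLike.norm_conj]; exact hK.norm_nodal_le c x)
  refine ⟨{ toFun := fun c => ell Ω ΓD g (hK.nodal ℂ c)
            map_add' := fun c c' => ?_
            map_smul' := fun k c => ?_ }, fun c => rfl, fun c => ?_⟩
  · unfold ell
    rw [← integral_add (hint c) (hint c')]
    refine integral_congr_ae (Eventually.of_forall fun x => ?_)
    rw [map_add]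
    simp [mul_add]
  · unfold ell
    rw [smul_eq_mul, ← integral_const_mul]
    refine integral_congr_ae (Eventually.of_forall fun x => ?_)
    rw [map_smul]
    simp
    ring
  · have h1 : ‖ell Ω ΓD g (hK.nodal ℂ c)‖ ≤ ∫ x in N, ‖g x‖ * ‖c‖ ∂arcLength := by
      refine norm_integral_le_of_norm_le (hg1.norm.mul_const _) (Eventually.of_forall fun x => ?_)
      rw [norm_mul, RCLike.norm_conj, Complex.norm_real]
      gcongr
      exact hK.norm_nodal_le c x
    refine h1.trans ?_
    rw [integral_mul_const]
    gcongr
    rw [integral_norm_eq_lintegral_enorm hg1.1, ← eLpNorm_one_eq_lintegral_enorm]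
    have h2 := eLpNorm_le_eLpNorm_mul_rpow_measure_univ (μ := arcLength.restrict N)
      (one_le_two (α := ENNReal)) hg.1
    refine (ENNReal.toReal_mono (ENNReal.mul_ne_top hg.2.ne ?_) h2).trans_eq ?_
    · exact ENNReal.rpow_ne_top_of_nonneg (by norm_num) (measure_ne_top _ _)
    · rw [ENNReal.toReal_mul, ← ENNReal.toReal_rpow, Measure.restrict_apply_univ, mul_comm,
        Real.sqrt_eq_rpow]
      norm_num

lemma eLpNorm_le_hHalfNorm (Γ : Set Plane) (u : Plane → ℝ) :
    eLpNorm u 2 (arcLength.restrict Γ) ≤ hHalfNorm Γ u := by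
  rw [eLpNorm_eq_lintegral_rpow_enorm_toReal two_ne_zero ENNReal.ofNat_ne_top, hHalfNorm]
  simp only [ENNReal.toReal_ofNat, ENNReal.rpow_ofNat]
  exact ENNReal.rpow_le_rpow le_self_add (by norm_num)

/-- The Scott-Zhang values on the Dirichlet part are controlled by the Dirichlet data. -/
lemma abs_scottZhangValue_le {a b : Plane} (hab : b ≠ a) {Γ : Set Plane}
    (hΓ : segment ℝ a b ⊆ Γ) {u ξ : Plane → ℝ} (hu : u =ᵐ[arcLength.restrict Γ] ξ)
    (hξ : MemHHalf Γ ξ) :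
    |scottZhangValue a b u| ≤ 4 / dist b a * √(dist b a) * (hHalfNorm Γ ξ).toReal := by
  have hd : 0 < dist b a := dist_pos.2 hab
  set ν := arcLength.restrict (segment ℝ a b) with hν
  have hle : ν ≤ arcLength.restrict Γ := Measure.restrict_mono_set _ hΓ
  have hlen : arcLength (segment ℝ a b) = ENNReal.ofReal (dist b a) := by
    rw [hausdorffMeasure_segment, edist_comm, edist_dist]
  have hξm : AEStronglyMeasurable ξ ν := hξ.1.mono_measure hle
  have hu' : u =ᵐ[ν] ξ := hle.absolutelyContinuous hu
  have hseg : MeasurableSet (segment ℝ a b) := by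
    rw [← convexHull_pair]
    exact (((finite_singleton b).insert a).isCompact_convexHull ℝ).isClosed.measurableSet
  have h1 : ‖scottZhangValue a b u‖ₑ ≤
      ENNReal.ofReal (4 / dist b a) * eLpNorm ξ 1 ν := by
    rw [eLpNorm_one_eq_lintegral_enorm, ← lintegral_const_mul' _ _ ENNReal.ofReal_ne_top]
    refine (enorm_integral_le_lintegral_enorm _).trans (lintegral_mono_ae ?_)
    filter_upwards [hu', ae_restrict_mem hseg] with x hx hxs
    rw [hx, enorm_mul]
    gcongr
    rw [← ofReal_norm]
    refine ENNReal.ofReal_le_ofReal ?_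
    rw [Real.norm_eq_abs, abs_div, abs_of_pos hd]
    gcongr
    -- With this ratio in `[0, 1]` the factor `4 - 6 λ` lies in `[-2, 4]`, whence the constant 4.
    have h2 : dist x a / dist b a ≤ 1 := by
      rw [div_le_one hd]
      have := mem_segment_iff_wbtw.1 hxs
      have h3 := this.dist_add_dist
      rw [dist_comm x a, dist_comm b a, ← h3]
      linarith [dist_nonneg (x := x) (y := b)]
    have h4 : 0 ≤ dist x a / dist b a := by positivity
    rw [abs_le]
    constructor <;> linarith
  have h2 : eLpNorm ξ 1 ν ≤ hHalfNorm Γ ξ * ENNReal.ofReal (dist b a) ^ (1 / 2 : ℝ) := by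
    refine (eLpNorm_le_eLpNorm_mul_rpow_measure_univ one_le_two hξm).trans ?_
    rw [hν, Measure.restrict_apply_univ, hlen, ← hν]
    refine mul_le_mul' ((eLpNorm_mono_measure ξ hle).trans (eLpNorm_le_hHalfNorm Γ ξ)) ?_
    norm_num
  have h3 := h1.trans (mul_le_mul_right h2 _)
  have hfin : hHalfNorm Γ ξ ≠ ⊤ := hξ.2.ne
  have h4 := ENNReal.toReal_mono (ENNReal.mul_ne_top ENNReal.ofReal_ne_top
    (ENNReal.mul_ne_top hfin (ENNReal.rpow_ne_top_of_nonneg (by norm_num)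
      ENNReal.ofReal_ne_top))) h3
  rw [toReal_enorm, ENNReal.toReal_mul, ENNReal.toReal_mul, ENNReal.toReal_ofReal (by positivity),
    ← ENNReal.toReal_rpow, ENNReal.toReal_ofReal hd.le, ← Real.sqrt_eq_rpow] at h4
  rw [← Real.norm_eq_abs]
  exact h4.trans_eq (by ring)

end Boundary

/-! ### Translation between the finite element problem and the abstract one -/

section Main

variable {K : Mesh} {Ω ΓD : Set Plane} {nb : Plane → Plane} {ζD ξD g : Plane → ℝ}

lemma ofReal_comp_mem_P1 {z : Plane → ℝ} (hz : z ∈ P1 ℝ K) :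
    (fun x => (z x : ℂ)) ∈ P1 ℂ K := by
  refine ⟨Complex.continuous_ofReal.comp_continuousOn hz.1, fun x hx => by simp [hz.2.1 x hx],
    fun t ht h3 => ?_⟩
  obtain ⟨f, hf⟩ := hz.2.2 t ht h3
  exact ⟨Complex.ofRealCLM.toLinearMap.toAffineMap.comp f, fun x hx => by simp [hf hx]⟩

open Classical in
/-- The vertex values prescribed on the Dirichlet part, extended by zero to the other vertices. -/
def dirichletValues (K : Mesh) (ΓD : Set Plane) (nb : Plane → Plane) (ζD : Plane → ℝ) :
    K.vertices → ℂ :=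
  fun a => if a.1 ∈ ΓD then (scottZhangValue a (nb a) ζD : ℂ) else 0

lemma sub_dirichletValues_mem_iff {c : K.vertices → ℂ} :
    c - dirichletValues K ΓD nb ζD ∈ dirichletZero K ΓD ↔
      ∀ a : K.vertices, a.1 ∈ ΓD → c a = (scottZhangValue a (nb a) ζD : ℂ) := by
  refine forall₂_congr fun a ha => ?_
  rw [Pi.sub_apply, sub_eq_zero, dirichletValues, if_pos ha]

/-- `ΓD` is a union of mesh edges, so two piecewise affine functions agreeing at its vertices agree
on all of it; interior nodal values of the interpolant play no role. -/
lemma IsTriangulation.nodal_mem_VhD_iff (hK : IsTriangulation K Ω) (hΓD : IsDirichletPart K Ω ΓD)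
    {c : K.vertices → ℂ} : (hK.nodal ℂ c : Plane → ℂ) ∈ VhD K ΓD nb ζD ↔
      c - dirichletValues K ΓD nb ζD ∈ dirichletZero K ΓD := by
  rw [sub_dirichletValues_mem_iff]
  constructor
  · rintro ⟨-, z, ⟨-, hz⟩, h⟩ a ha
    obtain ⟨h1, h2⟩ := h a ha
    rw [hK.nodal_vertex] at h1 h2
    rw [← hz a a.2]
    exact Complex.ext h1 h2
  · intro h
    obtain ⟨z, hz, hza⟩ := hK.exists_P1 fun a => scottZhangValue a (nb a) ζD
    refine ⟨(hK.nodal ℂ c).2, z, ⟨hz, hza⟩, fun x hx => ?_⟩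
    have hsub : (hK.nodal ℂ c).1 - (fun x => (z x : ℂ)) ∈ P1 ℂ K :=
      (P1 ℂ K).sub_mem (hK.nodal ℂ c).2 (ofReal_comp_mem_P1 hz)
    have h0 := hK.eq_zero_on_dirichlet hΓD hsub (fun a ha haD => by
      rw [Pi.sub_apply, hza a ha, hK.nodal_vertex c ⟨a, ha⟩, h ⟨a, ha⟩ haD, sub_self]) hx
    rw [Pi.sub_apply, sub_eq_zero] at h0
    rw [h0]
    simp

lemma IsTriangulation.nodal_mem_Vh0_iff (hK : IsTriangulation K Ω) (hΓD : IsDirichletPart K Ω ΓD)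
    {c : K.vertices → ℂ} :
    (hK.nodal ℂ c : Plane → ℂ) ∈ Vh0 K ΓD ↔ c ∈ dirichletZero K ΓD := by
  refine ⟨fun h a ha => ?_, fun h => ⟨(hK.nodal ℂ c).2, fun x hx => ?_⟩⟩
  · rw [← hK.nodal_vertex c a]
    exact h.2 a ha
  · exact hK.eq_zero_on_dirichlet hΓD (hK.nodal ℂ c).2
      (fun a ha haD => by rw [hK.nodal_vertex c ⟨a, ha⟩]; exact h ⟨a, ha⟩ haD) hx

lemma IsTriangulation.exists_nodal_eq (hK : IsTriangulation K Ω) {v : Plane → ℂ}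
    (hv : v ∈ Vh K) : ∃ c, (hK.nodal ℂ c : Plane → ℂ) = v :=
  ⟨(hK.nodal ℂ).symm ⟨v, hv⟩, by rw [LinearEquiv.apply_symm_apply]⟩

lemma IsTriangulation.isLinearSolution_iff [Fintype (Tri K)] [Fintype K.vertices]
    (hK : IsTriangulation K Ω) (hΩ : IsLipschitzDomain Ω) (hΓD : IsDirichletPart K Ω ΓD)
    {B : ℝ → Matrix (Fin 2) (Fin 2) ℝ} {M : ℝ} {C : ℝ≥0} (hB : IsLipschitzDiagonal B M C) {ε : ℝ}
    {l : (K.vertices → ℂ) →ₗ⋆[ℂ] ℂ} (hl : ∀ c, l c = ell Ω ΓD g (hK.nodal ℂ c))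
    {c u : K.vertices → ℂ} :
    IsLinearSolution (dirichletZero K ΓD) (hK.form B ε) l (dirichletValues K ΓD nb ζD) c u ↔
      (hK.nodal ℂ u : Plane → ℂ) ∈ VhD K ΓD nb ζD ∧
        Solves Ω K ΓD B ε g (hK.nodal ℂ c) (hK.nodal ℂ u) := by
  rw [IsLinearSolution, hK.nodal_mem_VhD_iff hΓD]
  refine and_congr_right fun _ => ⟨fun h ζ' hζ' => ?_, fun h w hw => ?_⟩
  · obtain ⟨w, rfl⟩ := hK.exists_nodal_eq hζ'.1
    rw [hK.aEps_eq hΩ hB, ← hl]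
    exact h w ((hK.nodal_mem_Vh0_iff hΓD).1 hζ')
  · have := h _ ((hK.nodal_mem_Vh0_iff hΓD).2 hw)
    rwa [hK.aEps_eq hΩ hB, ← hl] at this

/-- The prescribed vertex values are controlled by the Dirichlet data. -/
lemma exists_norm_dirichletValues_le [Fintype K.vertices]
    (hnb : IsScottZhangSelection K Ω ΓD nb) :
    ∃ k ≥ 0, ∀ ξD ζD : Plane → ℝ, MemHHalf ΓD ξD → ζD =ᵐ[arcLength.restrict ΓD] ξD →
      ‖dirichletValues K ΓD nb ζD‖ ≤ k * (hHalfNorm ΓD ξD).toReal := by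
  let q : K.vertices → ℝ := fun a => 4 / dist (nb a) a.1 * √(dist (nb a) a.1)
  have hq : ∀ a, 0 ≤ q a := fun a => by positivity
  refine ⟨∑ a, q a, Finset.sum_nonneg fun a _ => hq a, fun ξD ζD hξ hu => ?_⟩
  refine (pi_norm_le_iff_of_nonneg (mul_nonneg (Finset.sum_nonneg fun a _ => hq a)
    ENNReal.toReal_nonneg)).2 fun a => ?_
  have hqa : q a ≤ ∑ a, q a := Finset.single_le_sum (fun a _ => hq a) (Finset.mem_univ a)
  unfold dirichletValues
  split_ifs with ha
  · rw [Complex.norm_real, Real.norm_eq_abs]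
    refine (abs_scottZhangValue_le (hnb a a.2).1 ((hnb a a.2).2.2.2 ha) hu hξ).trans ?_
    exact mul_le_mul_of_nonneg_right hqa ENNReal.toReal_nonneg
  · rw [norm_zero]
    exact mul_nonneg ((hq a).trans hqa) ENNReal.toReal_nonneg

lemma isLipschitzDiagonal_Bhat {α β ξm ξp M : ℝ} {C : ℝ≥0}
    (hM : ∀ (s : ℝ) (i j : Fin 2), |Bhat α β ξm ξp s i j| ≤ M)
    (hC : ∀ i, LipschitzWith C fun s => Bhat α β ξm ξp s i i) :
    IsLipschitzDiagonal (Bhat α β ξm ξp) M C := by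
  refine ⟨fun s i j hij => ?_, fun s i => hM s i i, hC⟩
  fin_cases i <;> fin_cases j <;> simp_all [Bhat]

end Main

end Kirigami

end

/-! ### The main theorem -/

open Kirigami
theorem mainTheorem5
    -- domain, Dirichlet boundary, mesh, and edges selected for the Scott-Zhang interpolation
    (Ω : Set Plane) (hΩ : IsLipschitzDomain Ω)
    (K : Mesh) (hK : IsTriangulation K Ω)
    (ΓD : Set Plane) (hΓD : IsDirichletPart K Ω ΓD)
    (nb : Plane → Plane) (hnb : IsScottZhangSelection K Ω ΓD nb)
    -- parameters of the coefficients, with a bounded cut-off matrix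
    (α β ξm ξp : ℝ) (hα : α ≤ 0) (hβ : 0 ≤ β)
    (hξm : ξm ∈ Set.Icc (-(Real.pi / 2)) 0) (hξp : ξp ∈ Set.Icc 0 (Real.pi / 2))
    (hB : ∃ M > 0, ∀ (s : ℝ) (i j : Fin 2), |Bhat α β ξm ξp s i j| ≤ M)
    (ε : ℝ) (hε : 0 < ε) :
    (∀ ξD ζD g : Plane → ℝ, IsData Ω K ΓD ξD ζD g →
      -- the solution map of the linear problem is well defined
      (∀ ξ ∈ VhD K ΓD nb ζD, ∃! ζ : Plane → ℂ,
        ζ ∈ VhD K ΓD nb ζD ∧ Solves Ω K ΓD (Bhat α β ξm ξp) ε g ξ ζ) ∧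
      -- and Lipschitz
      (∃ L ≥ (0 : ℝ), ∀ ξ ∈ VhD K ΓD nb ζD, ∀ ξ' ∈ VhD K ΓD nb ζD,
        ∀ ζ ∈ VhD K ΓD nb ζD, ∀ ζ' ∈ VhD K ΓD nb ζD,
          Solves Ω K ΓD (Bhat α β ξm ξp) ε g ξ ζ → Solves Ω K ΓD (Bhat α β ξm ξp) ε g ξ' ζ' →
            vNorm Ω (fun x => ζ x - ζ' x) ≤ L * vNorm Ω (fun x => ξ x - ξ' x)) ∧
      -- and it has a fixed point: the nonlinear problem is solvable
      ∃ ξ ∈ VhD K ΓD nb ζD, Solves Ω K ΓD (Bhat α β ξm ξp) ε g ξ ξ) ∧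
    -- for small data the solution is unique
    ∃ δ > 0, ∀ ξD ζD g : Plane → ℝ, IsData Ω K ΓD ξD ζD g →
      hHalfNorm ΓD ξD ≤ ENNReal.ofReal δ →
      eLpNorm g 2 (arcLength.restrict (frontier Ω \ ΓD)) ≤ ENNReal.ofReal δ →
      ∃! ξ : Plane → ℂ, ξ ∈ VhD K ΓD nb ζD ∧ Solves Ω K ΓD (Bhat α β ξm ξp) ε g ξ ξ := by
  obtain ⟨C, hC⟩ := exists_lipschitz_Bhat hα hβ hξm hξp hB
  obtain ⟨M, -, hM⟩ := hB
  have hBd := isLipschitzDiagonal_Bhat hM hC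
  have := hK.finite_tri
  have := hK.finite_vertices
  let _ : Fintype (Tri K) := Fintype.ofFinite _
  let _ : Fintype K.vertices := Fintype.ofFinite _
  obtain ⟨κ, M', L, hfam⟩ := hK.exists_isCoerciveFamily hΩ hΓD hBd hε
  obtain ⟨k₁, hk₁, hup⟩ := hK.exists_vNorm_le hΩ
  obtain ⟨k₂, hk₂, hlow⟩ := hK.exists_norm_le_vNorm hΩ
  obtain ⟨k₃, hk₃, hdir⟩ := exists_norm_dirichletValues_le hnb
  have hκ := hfam.pos
  have hM' := hfam.bound_nonneg
  have hL := hfam.lip_nonneg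
  have hsub : ∀ c c' : K.vertices → ℂ, (fun x => (hK.nodal ℂ c : Plane → ℂ) x -
      (hK.nodal ℂ c' : Plane → ℂ) x) = (hK.nodal ℂ (c - c') : Plane → ℂ) := fun c c' => by
    rw [map_sub]; rfl
  have main : ∀ ξD ζD g : Plane → ℝ, IsData Ω K ΓD ξD ζD g →
      ∃ ξ ∈ VhD K ΓD nb ζD, Solves Ω K ΓD (Bhat α β ξm ξp) ε g ξ ξ := by
    intro ξD ζD g hdata
    obtain ⟨l, hl, hlb⟩ := hK.exists_ell hΩ hΓD hdata.neumann
    obtain ⟨u, hu⟩ := hfam.exists_fixedPoint (by positivity) hlb (dirichletValues K ΓD nb ζD)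
    exact ⟨_, (hK.isLinearSolution_iff hΩ hΓD hBd hl).1 hu⟩
  refine ⟨fun ξD ζD g hdata => ⟨fun ξ hξ => ?_, ?_, main ξD ζD g hdata⟩, ?_⟩
  · obtain ⟨l, hl, -⟩ := hK.exists_ell hΩ hΓD hdata.neumann
    obtain ⟨c, rfl⟩ := hK.exists_nodal_eq hξ.1
    obtain ⟨u, hu, huniq⟩ := hfam.existsUnique l (dirichletValues K ΓD nb ζD) c
    refine ⟨_, (hK.isLinearSolution_iff hΩ hΓD hBd hl).1 hu, fun ζ hζ => ?_⟩
    obtain ⟨u', rfl⟩ := hK.exists_nodal_eq hζ.1.1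
    rw [huniq u' ((hK.isLinearSolution_iff hΩ hΓD hBd hl).2 hζ)]
  · obtain ⟨l, hl, hlb⟩ := hK.exists_ell hΩ hΓD hdata.neumann
    set Λ := √(arcLength (frontier Ω \ ΓD)).toReal *
      (eLpNorm g 2 (arcLength.restrict (frontier Ω \ ΓD))).toReal
    have hΛ : 0 ≤ Λ := by positivity
    -- `S` is the a priori bound for all solutions of the linear problem; `k₁` and `k₂` convert
    -- between the two norms.
    set S := ‖dirichletValues K ΓD nb ζD‖ + (Λ + M' * ‖dirichletValues K ΓD nb ζD‖) / κ
    have hS : 0 ≤ S := by positivity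
    refine ⟨k₁ * (L * S / κ) * k₂, by positivity,
      fun ξ hξ ξ' hξ' ζ hζ ζ' hζ' hsol hsol' => ?_⟩
    obtain ⟨c, rfl⟩ := hK.exists_nodal_eq hξ.1
    obtain ⟨c', rfl⟩ := hK.exists_nodal_eq hξ'.1
    obtain ⟨u, rfl⟩ := hK.exists_nodal_eq hζ.1
    obtain ⟨u', rfl⟩ := hK.exists_nodal_eq hζ'.1
    have hu := (hK.isLinearSolution_iff hΩ hΓD hBd hl).2 ⟨hζ, hsol⟩
    have hu' := (hK.isLinearSolution_iff hΩ hΓD hBd hl).2 ⟨hζ', hsol'⟩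
    rw [hsub, hsub]
    calc vNorm Ω (hK.nodal ℂ (u - u')) ≤ k₁ * ‖u - u'‖ := hup _
      _ ≤ k₁ * (L * ‖u'‖ / κ * ‖c - c'‖) := by gcongr; exact hfam.norm_sub_le hu hu'
      _ ≤ k₁ * (L * S / κ * (k₂ * vNorm Ω (hK.nodal ℂ (c - c')))) := by
        gcongr
        · exact hfam.norm_le_of_isLinearSolution hΛ hlb hu'
        · exact hlow _
      _ = _ := by ring
  · set A := √(arcLength (frontier Ω \ ΓD)).toReal
    -- For data of size at most `δ` the contraction factor is at most `Q δ`, and `δ = 1 / (Q + 1)`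
    -- makes this less than 1. No constant in `Q` depends on the data.
    set Q := L * (k₃ + (A + M' * k₃) / κ) / κ
    have hQ : 0 ≤ Q := by positivity
    refine ⟨1 / (Q + 1), by positivity, fun ξD ζD g hdata hξδ hgδ => ?_⟩
    set δ := 1 / (Q + 1)
    have hδ : 0 < δ := by positivity
    obtain ⟨ξ, hξ, hsol⟩ := main ξD ζD g hdata
    refine ⟨ξ, ⟨hξ, hsol⟩, fun ξ' hξ' => ?_⟩
    obtain ⟨l, hl, hlb⟩ := hK.exists_ell hΩ hΓD hdata.neumann
    obtain ⟨u, rfl⟩ := hK.exists_nodal_eq hξ.1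
    obtain ⟨u', rfl⟩ := hK.exists_nodal_eq hξ'.1.1
    have hz : ‖dirichletValues K ΓD nb ζD‖ ≤ k₃ * δ :=
      (hdir ξD ζD hdata.dirichlet hdata.trace_eq).trans (by
        gcongr
        exact ENNReal.toReal_le_of_le_ofReal hδ.le hξδ)
    have hg : (eLpNorm g 2 (arcLength.restrict (frontier Ω \ ΓD))).toReal ≤ δ :=
      ENNReal.toReal_le_of_le_ofReal hδ.le hgδ
    have hlb' : ∀ c, ‖l c‖ ≤ (A * δ) * ‖c‖ := fun c => (hlb c).trans (by gcongr)
    have hsmall : L * (‖dirichletValues K ΓD nb ζD‖ +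
        (A * δ + M' * ‖dirichletValues K ΓD nb ζD‖) / κ) / κ < 1 := by
      calc _ ≤ L * (k₃ * δ + (A * δ + M' * (k₃ * δ)) / κ) / κ := by gcongr
        _ = Q * δ := by simp only [Q]; field_simp
        _ < 1 := by
          rw [mul_one_div, div_lt_one (by positivity)]
          linarith
    rw [hfam.eq_of_fixedPoint (by positivity) hlb' hsmall
      ((hK.isLinearSolution_iff hΩ hΓD hBd hl).2 hξ')
      ((hK.isLinearSolution_iff hΩ hΓD hBd hl).2 ⟨hξ, hsol⟩)]
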